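/- Let $n\ge 0$. For a nonempty finite set $X\subset\mathbb R^n$ and $z\in\mathbb R^n$ let $d_X(z)=\min_{x\in X}\|z-x\|$, let $\Pi_X(z)=\{x\in X:\|z-x\|=d_X(z)\}$, let $\mathrm{Conv}$ denote the convex hull, and let $S_z=\mathrm{Span}(\Pi_X(z)-z)$ be the linear span of $\{x-z: x\in\Pi_X(z)\}$. Let $f:\mathbb R^n\to\mathbb R$ be continuous and $z\in\mathbb R^n$. The point $z$ is a topological regular point of $f$ if $n\geq 1$ and there is a homeomorphism $\phi:V_1\to V_2$ between open neighborhoods $V_1$ of $0$ and $V_2$ of $z$ in $\mathbb R^n$ with $\phi(0)=z$ and $f(\phi(p))=f(z)+p_1$ for all $p\in V_1$; otherwise $z$ is a topological critical point of $f$. A topological critical point $z$ is nondegenerate of index $m\in\{0,\dots,n\}$ if there is a homeomorphism $\phi:V_1\to V_2$ between open neighborhoods $V_1$ of $0$ and $V_2$ of $z$ in $\mathbb R^n$ with $\phi(0)=z$ and $$f(\phi(p))=f(z)-\sum_{i=1}^m p_i^2+\sum_{i=m+1}^n p_i^2\qquad\text{for all } p\in V_1.$$ The function $f$ is a topological Morse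 function if it is continuous and each of its topological critical points is nondegenerate of some index. **Theorem.** Let $X\subset\mathbb R^n$ be a nonempty finite set. Then $d_X:\mathbb R^n\to\mathbb R$ is a topological Morse function. Furthermore: - Every point of $X$ is a nondegenerate topological critical point of $d_X$ of index $0$. - Let $z\in\mathbb R^n\setminus X$ be such that $z\in\mathrm{Conv}(\Pi_X(z))$. If there exists $v\in S_z\setminus\{0\}$ such that $\langle v,x-z\rangle\le 0$ for all $x\in\Pi_X(z)$, then $z$ is a topological regular point of $d_X$. Otherwise, $z$ is a nondegenerate topological critical point of $d_X$ of index $\dim S_z$. - Every other point of $\mathbb R^n$, that is, every $z\in\mathbb R^n\setminus X$ with $z\notin\mathrm{Conv}(\Pi_X(z))$, is a topological regular point of $d_X$. -/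

import Mathlib

open scoped BigOperators

/-- `z` is a topological regular point of `f : ℝⁿ → ℝ`: there is a homeomorphism `φ` from an open
neighbourhood of `0` onto an open neighbourhood of `z`, with `φ 0 = z`, such that
`f (φ p) = f z + p₁` on its domain. There is a first coordinate only if `0 < n`. -/
def IsTopRegularPt {n : ℕ} (f : EuclideanSpace ℝ (Fin n) → ℝ)
    (z : EuclideanSpace ℝ (Fin n)) : Prop :=
  ∃ (hn : 0 < n)
    (φ : OpenPartialHomeomorph (EuclideanSpace ℝ (Fin n)) (EuclideanSpace ℝ (Fin n))),
    0 ∈ φ.source ∧ φ 0 = z ∧ ∀ p ∈ φ.source, f (φ p) = f z + p ⟨0, hn⟩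

/-- A topological critical point is a point that is not topologically regular. -/
def IsTopCriticalPt {n : ℕ} (f : EuclideanSpace ℝ (Fin n) → ℝ)
    (z : EuclideanSpace ℝ (Fin n)) : Prop :=
  ¬ IsTopRegularPt f z

/-- `z` is a nondegenerate topological critical point of `f` of index `m`: it is a topological
critical point, and in suitable local topological coordinates `φ` centred at `z` one has
`f (φ p) = f z - (p₁² + ⋯ + pₘ²) + (pₘ₊₁² + ⋯ + pₙ²)`. -/
def IsNondegTopCriticalPt {n : ℕ} (f : EuclideanSpace ℝ (Fin n) → ℝ)
    (z : EuclideanSpace ℝ (Fin n)) (m : ℕ) : Prop :=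
  IsTopCriticalPt f z ∧ m ≤ n ∧
    ∃ φ : OpenPartialHomeomorph (EuclideanSpace ℝ (Fin n)) (EuclideanSpace ℝ (Fin n)),
      0 ∈ φ.source ∧ φ 0 = z ∧ ∀ p ∈ φ.source,
        f (φ p) = f z - ∑ i : Fin n with i.val < m, p i ^ 2 + ∑ i : Fin n with m ≤ i.val, p i ^ 2

/-- A topological Morse function on `ℝⁿ`: a continuous function all of whose topological critical
points are nondegenerate (of some index). -/
def IsTopMorse {n : ℕ} (f : EuclideanSpace ℝ (Fin n) → ℝ) : Prop :=
  Continuous f ∧ ∀ z, IsTopCriticalPt f z → ∃ m : ℕ, IsNondegTopCriticalPt f z m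

/-- The set `Π_X(z)` of projections of `z` on `X`, i.e. the points of `X` nearest to `z`. -/
def nearestPts {n : ℕ} (X : Set (EuclideanSpace ℝ (Fin n)))
    (z : EuclideanSpace ℝ (Fin n)) : Set (EuclideanSpace ℝ (Fin n)) :=
  {x | x ∈ X ∧ dist z x = Metric.infDist z X}

/-- The linear span of `Π_X(z) - z`. -/
def nearestSpan {n : ℕ} (X : Set (EuclideanSpace ℝ (Fin n)))
    (z : EuclideanSpace ℝ (Fin n)) : Submodule ℝ (EuclideanSpace ℝ (Fin n)) :=
  Submodule.span ℝ ((fun x => x - z) '' nearestPts X z)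

/-! Near `z`, only the nearest points matter: with `P = Π_X(z) - z` and `h = maxInner P` its support
function, d(z+u)² = d(z)² + ‖u‖² - 2h(u) (`exists_finset_sq_infDist_eq`). Everything is read off the
sign of `h` on S = span P.

If `z` is outside the hull, some direction `e` has h(e) < 0 and the distance increases strictly
along all nearby lines parallel to `e`. If `z` is in the hull, then h ≥ 0. When `h` vanishes at some
nonzero vector of `S`, parallel lines need not suffice; the distance increases instead along lines
of direction e - β Pu, where Pu is the projection of `u` on `S`, β is large, and `e` has positive
inner product with every nonzero w in `S` such that h(w) ≤ 0. In both cases the lines are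
straightened and the function itself becomes a coordinate (`isTopRegularPt_of_strictMono_along`).

If h > 0 on S \ {0}, write u = s + w with s in `S` and w orthogonal to `S`. Then d² - d(z)² = ‖w‖² -
(2h(s) - ‖s‖²). A radial homeomorphism of `S` turns the bracket into a squared norm, and a rescaling
by the square root of d + d(z) passes from d² to d (`exists_chart_of_sq_eq_add_sub_maxInner`). At a
point of `X`, d is locally ‖u‖, and u = ‖p‖p is a chart.

Criticality is a linking argument (`not_isTopRegularPt_of_saddle`): a regular chart would push a
disc of `S` below the level of `z` with its boundary fixed, hence off the orthogonal complement of
`S`, against the no-retraction theorem. The latter is proved by integrating a Jacobian determinant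
that is polynomial in a parameter. -/

open Metric in
/-- A map that vanishes on a sphere and is Lipschitz on the closed ball stays Lipschitz
when it is cut off outside of the ball. -/
theorem lipschitzWith_indicator_closedBall {E : Type*} [NormedAddCommGroup E]
    [NormedSpace ℝ E] {v : E → E} {R : ℝ} {K : NNReal}
    (hv : LipschitzOnWith K v (closedBall 0 R)) (h0 : ∀ x, ‖x‖ = R → v x = 0) :
    LipschitzWith K ((closedBall (0 : E) R).indicator v) := by
  -- The segment from `x` to `y` meets the sphere at a point where `v` vanishes, and that point is
  -- no farther from `x` than `y` is.
  have key : ∀ x y : E, ‖x‖ ≤ R → R < ‖y‖ → ‖v x‖ ≤ K * ‖x - y‖ := by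
    intro x y hx hy
    have hc : ContinuousOn (fun t : ℝ => ‖x + t • (y - x)‖) (Set.Icc 0 1) := by fun_prop
    obtain ⟨t, ht, htR⟩ := intermediate_value_Icc zero_le_one hc
      (show R ∈ Set.Icc _ _ by simp; exact ⟨hx, hy.le⟩)
    have hq := hv.norm_sub_le (x := x) (y := x + t • (y - x)) (by simpa using hx)
      (by simpa using htR.le)
    rw [h0 _ htR, sub_zero] at hq
    refine hq.trans ?_
    gcongr
    rw [sub_add_cancel_left, norm_neg, norm_smul, Real.norm_of_nonneg ht.1, norm_sub_rev x y]
    exact mul_le_of_le_one_left (norm_nonneg _) ht.2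
  refine LipschitzWith.of_dist_le_mul fun x y => ?_
  rw [dist_eq_norm, dist_eq_norm]
  by_cases hx : ‖x‖ ≤ R <;> by_cases hy : ‖y‖ ≤ R
  · rw [Set.indicator_of_mem (by simpa using hx), Set.indicator_of_mem (by simpa using hy)]
    exact hv.norm_sub_le (by simpa using hx) (by simpa using hy)
  · rw [Set.indicator_of_mem (by simpa using hx), Set.indicator_of_notMem (by simpa using hy),
      sub_zero]
    exact key x y hx (not_le.1 hy)
  · rw [Set.indicator_of_notMem (by simpa using hx), Set.indicator_of_mem (by simpa using hy),
      zero_sub, norm_neg, norm_sub_rev]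
    exact key y x hy (not_le.1 hx)
  · rw [Set.indicator_of_notMem (by simpa using hx), Set.indicator_of_notMem (by simpa using hy)]
    simp; positivity

/-! ### The no-retraction theorem -/

section NoRetraction

variable {E : Type*} [NormedAddCommGroup E] [InnerProductSpace ℝ E] [FiniteDimensional ℝ E]

open Metric MeasureTheory Polynomial in
/-- Along a line through the identity, the determinant of an endomorphism is a polynomial function
of bounded degree. -/
theorem exists_polynomial_eval_eq_det_id_add_smul (D : E →L[ℝ] E) :
    ∃ p : ℝ[X], p.natDegree ≤ Module.finrank ℝ E ∧
      ∀ t : ℝ, p.eval t = (ContinuousLinearMap.id ℝ E + t • D).det := by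
  classical
  let b := Module.finBasis ℝ E
  let M := LinearMap.toMatrix b b (D : E →ₗ[ℝ] E)
  refine ⟨Matrix.det ((X : ℝ[X]) • M.map C + (1 : Matrix _ _ ℝ).map C), ?_, fun t => ?_⟩
  · simpa using Polynomial.natDegree_det_X_add_C_le M 1
  · rw [ContinuousLinearMap.det, ← LinearMap.det_toMatrix b, ← coe_evalRingHom, RingHom.map_det]
    congr 1
    ext i j
    rcases eq_or_ne i j with rfl | h
    · simp [M, LinearMap.toMatrix_apply]; ring
    · simp [M, LinearMap.toMatrix_apply, h]; ring

open Metric in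
/-- A small Lipschitz perturbation of the identity, supported in a closed ball and vanishing on its
boundary, maps the open ball bijectively onto itself. -/
theorem bijOn_ball_add_smul {v : E → E} {R : ℝ} {K : NNReal}
    (hv : LipschitzOnWith K v (closedBall 0 R)) (h0 : ∀ x, ‖x‖ = R → v x = 0)
    {t : ℝ} (ht0 : 0 ≤ t) (ht : t * K < 1) :
    Set.BijOn (fun x => x + t • v x) (ball 0 R) (ball 0 R) := by
  set w := (closedBall (0 : E) R).indicator v with hw
  have hwl := lipschitzWith_indicator_closedBall hv h0
  let c : NNReal := t.toNNReal * K
  have hct : (c : ℝ) = t * K := by simp [c, ht0]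
  have hc : c < 1 := by rw [← NNReal.coe_lt_coe, hct]; exact ht
  -- After the cut-off, the map is a perturbation of the identity with Lipschitz constant below 1 on
  -- the whole space, hence a homeomorphism. It fixes every point outside the open ball, so
  -- injectivity forces it to preserve the ball.
  have happ : ApproximatesLinearOn (fun x => x + t • w x)
      ((ContinuousLinearEquiv.refl ℝ E : E ≃L[ℝ] E) : E →L[ℝ] E) Set.univ c := by
    refine LipschitzOnWith.approximatesLinearOn (fun x _ y _ => ?_)
    rw [edist_dist, edist_dist, ← ENNReal.ofReal_coe_nnreal, ← ENNReal.ofReal_mul (by positivity)]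
    refine ENNReal.ofReal_le_ofReal ?_
    have := hwl.dist_le_mul x y
    simp only [dist_eq_norm] at this ⊢
    simp only [Pi.sub_apply, ContinuousLinearEquiv.coe_refl, ContinuousLinearMap.coe_id', id_eq,
      add_sub_cancel_left, ← smul_sub, norm_smul, Real.norm_of_nonneg ht0]
    calc t * ‖w x - w y‖ ≤ t * (K * ‖x - y‖) := by gcongr
      _ = c * ‖x - y‖ := by rw [hct]; ring
  have hN : Subsingleton E ∨ c < ‖((ContinuousLinearEquiv.refl ℝ E).symm : E →L[ℝ] E)‖₊⁻¹ := by
    rcases subsingleton_or_nontrivial E with h | h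
    · exact Or.inl h
    · right
      have : ‖((ContinuousLinearEquiv.refl ℝ E).symm : E →L[ℝ] E)‖₊ = 1 := by
        ext; exact ContinuousLinearMap.norm_id
      rw [this]; simpa using hc
  let H := happ.toHomeomorph _ hN
  have hH : ∀ x, H x = x + t • w x := fun x => rfl
  have hout : ∀ x, R ≤ ‖x‖ → H x = x := by
    intro x hx
    rw [hH]
    rcases hx.eq_or_lt with h | h
    · rw [hw, Set.indicator_of_mem (by simp [h]), h0 x h.symm]; simp
    · rw [hw, Set.indicator_of_notMem (by simpa using h)]; simp
  have hin : ∀ x ∈ ball (0 : E) R, H x = x + t • v x := by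
    intro x hx
    rw [hH, hw, Set.indicator_of_mem (ball_subset_closedBall hx)]
  have hmaps : ∀ x, H x ∈ ball (0 : E) R ↔ x ∈ ball (0 : E) R := by
    intro x
    simp only [mem_ball_zero_iff]
    constructor
    · intro h
      by_contra hx
      rw [hout x (not_lt.1 hx)] at h
      exact hx h
    · intro hx
      by_contra h
      have h2 : H (H x) = H x := hout _ (not_lt.1 h)
      rw [H.injective h2] at h
      exact h hx
  refine Set.BijOn.congr (f₁ := H) ⟨fun x hx => (hmaps x).2 hx, H.injective.injOn, fun y hy => ?_⟩
    (fun x hx => hin x hx)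
  obtain ⟨x, rfl⟩ := H.surjective y
  exact ⟨x, (hmaps x).1 hy, rfl⟩

open Metric MeasureTheory in
/-- There is no `C¹` map into a sphere which is the identity on that sphere. -/
theorem not_exists_contDiff_retraction_sphere {h : E → E} {R : ℝ} (hR : 0 < R)
    (hh : ContDiff ℝ 1 h) (hid : ∀ x, ‖x‖ = R → h x = x) (hsph : ∀ x, ‖h x‖ = R) : False := by
  classical
  borelize E
  let μ : Measure E := Measure.addHaar
  set v : E → E := fun x => h x - x with hvdef
  have hvC : ContDiff ℝ 1 v := hh.sub contDiff_id
  have hv0 : ∀ x, ‖x‖ = R → v x = 0 := fun x hx => by simp [hvdef, hid x hx]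
  obtain ⟨M, hM⟩ : ∃ M, ∀ x ∈ closedBall (0 : E) R, ‖fderiv ℝ v x‖ ≤ M :=
    (isCompact_closedBall 0 R).exists_bound_of_continuousOn
      (hvC.continuous_fderiv one_ne_zero).continuousOn
  have hM0 : 0 ≤ M := (norm_nonneg _).trans (hM 0 (by simp [hR.le]))
  have hlip : LipschitzOnWith ⟨M, hM0⟩ v (closedBall 0 R) :=
    (convex_closedBall 0 R).lipschitzOnWith_of_nnnorm_fderiv_le
      (fun x _ => (hvC.differentiable one_ne_zero) x) (fun x hx => hM x hx)
  -- near the identity the determinant is positive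
  obtain ⟨ε, hε, hdet⟩ : ∃ ε > 0, ∀ A : E →L[ℝ] E, ‖A - ContinuousLinearMap.id ℝ E‖ < ε →
      0 < A.det := by
    have : ∀ᶠ A in nhds (ContinuousLinearMap.id ℝ E), 0 < A.det :=
      (ContinuousLinearMap.continuous_det (𝕜 := ℝ) (E := E)).continuousAt.eventually_const_lt
        (by simp [ContinuousLinearMap.det])
    obtain ⟨ε, hε, h⟩ := Metric.eventually_nhds_iff.1 this
    exact ⟨ε, hε, fun A hA => h (by rwa [dist_eq_norm])⟩
  -- By change of variables `J t` is the volume of the ball for small `t` ≥ 0. The integrand is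
  -- polynomial in `t`, so the same value persists at `t = 1`, where however the integrand is the
  -- determinant of the derivative of `h`, which is zero.
  let J : ℝ → ℝ := fun t => ∫ x in ball (0 : E) R, (ContinuousLinearMap.id ℝ E + t • fderiv ℝ v x).det ∂μ
  have hcont : ∀ t : ℝ, Continuous fun x =>
      (ContinuousLinearMap.id ℝ E + t • fderiv ℝ v x).det := fun t =>
    ContinuousLinearMap.continuous_det.comp
      (continuous_const.add ((hvC.continuous_fderiv one_ne_zero).const_smul t))
  have hint : ∀ t : ℝ, IntegrableOn (fun x =>
      (ContinuousLinearMap.id ℝ E + t • fderiv ℝ v x).det) (ball (0 : E) R) μ := fun t =>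
    ((hcont t).continuousOn.integrableOn_compact (isCompact_closedBall 0 R)).mono_set
      ball_subset_closedBall
  have hsmall : ∀ t : ℝ, 0 ≤ t → t * M < 1 → t * M < ε → J t = μ.real (ball 0 R) := by
    intro t ht0 ht1 ht2
    have hbij := bijOn_ball_add_smul hlip hv0 ht0 ht1
    have hder : ∀ x ∈ ball (0 : E) R, HasFDerivWithinAt (fun x => x + t • v x)
        (ContinuousLinearMap.id ℝ E + t • fderiv ℝ v x) (ball 0 R) x := fun x _ =>
      ((hasFDerivAt_id x).add (((hvC.differentiable one_ne_zero) x).hasFDerivAt.const_smul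
        t)).hasFDerivWithinAt
    have hcv := lintegral_abs_det_fderiv_eq_addHaar_image μ measurableSet_ball hder hbij.injOn
    rw [hbij.image_eq] at hcv
    have hpos : ∀ x ∈ ball (0 : E) R,
        0 ≤ (ContinuousLinearMap.id ℝ E + t • fderiv ℝ v x).det := by
      intro x hx
      refine (hdet _ ?_).le
      rw [add_sub_cancel_left, norm_smul, Real.norm_of_nonneg ht0]
      exact (mul_le_mul_of_nonneg_left (hM x (ball_subset_closedBall hx)) ht0).trans_lt ht2
    simp only [J, Measure.real]
    rw [← hcv, integral_eq_lintegral_of_nonneg_ae]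
    · congr 1
      refine setLIntegral_congr_fun measurableSet_ball fun x hx => ?_
      simp only [abs_of_nonneg (hpos x hx)]
    · exact (ae_restrict_iff' measurableSet_ball).2 (Filter.Eventually.of_forall hpos)
    · exact (hcont t).aestronglyMeasurable
  -- interpolation
  let d := Module.finrank ℝ E
  obtain ⟨τ, hτ, hτ1, hτ2⟩ : ∃ τ > 0, τ * M < 1 ∧ τ * M < ε := by
    refine ⟨min 1 ε / (2 * (M + 1)), by positivity, ?_, ?_⟩ <;>
    · have h1 : min 1 ε / (2 * (M + 1)) * M = min 1 ε * (M / (2 * (M + 1))) := by ring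
      have h2 : M / (2 * (M + 1)) < 1 := by rw [div_lt_one (by positivity)]; linarith
      rw [h1]
      have h3 : 0 < min 1 ε := by positivity
      have := mul_lt_of_lt_one_right h3 h2
      linarith [min_le_left 1 ε, min_le_right 1 ε]
  -- These are `d + 1` distinct nodes in (0, τ]. Lagrange interpolation expresses the value at 1
  -- through the values at the nodes with weights independent of `x`, so it commutes with the
  -- integral and no coefficient of the polynomial has to be integrated.
  let node : ℕ → ℝ := fun i => τ / (i + 1)
  have hnode : Set.InjOn node (Finset.range (d + 1)) := by
    intro i _ j _ hij
    simp only [node] at hij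
    rw [div_eq_div_iff (by positivity) (by positivity)] at hij
    have := mul_left_cancel₀ hτ.ne' hij
    exact_mod_cast (add_right_cancel this).symm
  let ℓ : ℕ → ℝ := fun i => (Lagrange.basis (Finset.range (d + 1)) node i).eval 1
  have hℓ : ∑ i ∈ Finset.range (d + 1), ℓ i = 1 := by
    have := congrArg (Polynomial.eval 1) (Lagrange.sum_basis hnode (by simp))
    rwa [Polynomial.eval_finsetSum, Polynomial.eval_one] at this
  have hJ1 : J 1 = ∑ i ∈ Finset.range (d + 1), ℓ i * J (node i) := by
    simp only [J, ← integral_const_mul]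
    rw [← integral_finsetSum _ fun i _ => (hint (node i)).const_mul _]
    congr 1
    ext x
    obtain ⟨p, hpd, hp⟩ := exists_polynomial_eval_eq_det_id_add_smul (fderiv ℝ v x)
    have hlt : p.degree < (Finset.range (d + 1)).card := by
      rw [Finset.card_range]
      exact (Polynomial.degree_le_natDegree).trans_lt (by exact_mod_cast Nat.lt_succ_of_le hpd)
    have hpi := congrArg (Polynomial.eval 1) (Lagrange.eq_interpolate hnode hlt)
    rw [Lagrange.interpolate_apply, Polynomial.eval_finsetSum] at hpi
    simp only [Polynomial.eval_mul, Polynomial.eval_C, hp] at hpi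
    rw [hpi]
    exact Finset.sum_congr rfl fun i _ => mul_comm _ _
  have hJ : J 1 = μ.real (ball 0 R) := by
    rw [hJ1]
    have : ∀ i ∈ Finset.range (d + 1), ℓ i * J (node i) = ℓ i * μ.real (ball 0 R) := by
      intro i _
      have hle : node i ≤ τ := div_le_self hτ.le (by linarith [Nat.cast_nonneg (α := ℝ) i])
      have hle' := mul_le_mul_of_nonneg_right hle hM0
      rw [hsmall (node i) (by positivity) (by linarith) (by linarith)]
    rw [Finset.sum_congr rfl this, ← Finset.sum_mul, hℓ, one_mul]
  have hJ0 : J 1 = 0 := by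
    simp only [J]
    refine integral_eq_zero_of_ae (Filter.Eventually.of_forall fun x => ?_)
    have hD : ContinuousLinearMap.id ℝ E + (1 : ℝ) • fderiv ℝ v x = fderiv ℝ h x := by
      have h1 : HasFDerivAt v (fderiv ℝ h x - ContinuousLinearMap.id ℝ E) x :=
        ((hh.differentiable one_ne_zero) x).hasFDerivAt.sub (hasFDerivAt_id x)
      rw [h1.fderiv]; simp
    simp only [Pi.zero_apply]
    rw [hD]
    -- If the derivative were invertible, some `w` would be sent to `h x`. Differentiating the
    -- constant ‖h‖² along `w` would then give 2R² = 0.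
    by_contra hne
    have hunit : IsUnit (LinearMap.det (fderiv ℝ h x : E →ₗ[ℝ] E)) := IsUnit.mk0 _ hne
    obtain ⟨w, hw⟩ : ∃ w, fderiv ℝ h x w = h x :=
      ((Module.End.isUnit_iff _).1 ((LinearMap.isUnit_iff_isUnit_det _).2 hunit)).2 (h x)
    have h2 : HasFDerivAt (fun y => ‖h y‖ ^ 2) _ x :=
      ((hh.differentiable one_ne_zero) x).hasFDerivAt.norm_sq
    have h3 : HasFDerivAt (fun y => ‖h y‖ ^ 2) (0 : E →L[ℝ] ℝ) x := by
      simp only [hsph]; exact hasFDerivAt_const _ _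
    have h4 := congrArg (fun L : E →L[ℝ] ℝ => L w) (h2.unique h3)
    simp [hw, hsph] at h4
    exact hR.ne' h4
  have hpos : 0 < μ.real (ball (0 : E) R) :=
    ENNReal.toReal_pos (measure_ball_pos μ 0 hR).ne' measure_ball_lt_top.ne
  linarith

/-- A continuous self-map of a Euclidean space which is the identity outside of a ball has a zero. -/
theorem exists_eq_zero_of_eq_self_outside_ball {r : E → E} (hr : Continuous r) {ρ : ℝ} (hρ : 0 ≤ ρ)
    (hid : ∀ x, ρ ≤ ‖x‖ → r x = x) : ∃ x, r x = 0 := by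
  by_contra! hne
  -- Approximating within ‖r x‖ keeps `g` away from zero. Since `r` is the identity, hence smooth,
  -- on ρ < ‖x‖, `g` may be taken equal to `r` on ρ + 1 ≤ ‖x‖. Radial projection of `g` is then a
  -- retraction onto the sphere of radius ρ + 1.
  obtain ⟨g, hg, hgr, hgS, -⟩ := hr.exists_contDiff_approx_and_eqOn (ε := fun x => ‖r x‖) 1
    hr.norm (fun x => norm_pos_iff.2 (hne x)) (S := {x | ρ + 1 ≤ ‖x‖}) (U := {x | ρ < ‖x‖})
    (isClosed_le continuous_const continuous_norm)
    ((isOpen_lt continuous_const continuous_norm).mem_nhdsSet.2 fun x hx => by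
      simp only [Set.mem_ofPred_eq] at hx ⊢; linarith)
    (contDiffOn_id.congr fun x hx => hid x (le_of_lt hx))
  have hg0 : ∀ x, g x ≠ 0 := fun x hx => by
    have := hgr x
    rw [hx, dist_zero_left] at this
    exact lt_irrefl _ this
  have hR : 0 < ρ + 1 := by linarith
  refine not_exists_contDiff_retraction_sphere (h := fun x => ((ρ + 1) * ‖g x‖⁻¹) • g x) hR ?_ ?_ ?_
  · exact (contDiff_const.mul ((hg.norm ℝ hg0).inv fun x => norm_ne_zero_iff.2 (hg0 x))).smul hg
  · intro x hx
    have h1 : g x = x := (hgS hx.ge).trans (hid x (by linarith))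
    simp only [h1, hx]
    rw [mul_inv_cancel₀ hR.ne', one_smul]
  · intro x
    have := norm_pos_iff.2 (hg0 x)
    rw [norm_smul, Real.norm_of_nonneg (by positivity)]
    field_simp

end NoRetraction

/-! ### Charts at topologically regular points -/

section Charts

/-- Two continuous maps which are inverse to each other near corresponding points restrict to an
open partial homeomorphism. -/
theorem exists_openPartialHomeomorph_of_leftInvOn {X Y : Type*} [TopologicalSpace X]
    [TopologicalSpace Y] {φ : X → Y} {ψ : Y → X} {U : Set X} {V : Set Y} {a : X}
    (hU : IsOpen U) (hV : IsOpen V) (hφ : ContinuousOn φ U) (hψ : ContinuousOn ψ V)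
    (haU : a ∈ U) (haV : φ a ∈ V) (hl : Set.LeftInvOn ψ φ U) (hr : Set.LeftInvOn φ ψ V) :
    ∃ e : OpenPartialHomeomorph X Y, a ∈ e.source ∧ ⇑e = φ ∧ e.source ⊆ U :=
  ⟨{ toFun := φ
     invFun := ψ
     source := U ∩ φ ⁻¹' V
     target := V ∩ ψ ⁻¹' U
     map_source' := fun x hx => ⟨hx.2, by simpa only [Set.mem_preimage, hl hx.1] using hx.1⟩
     map_target' := fun y hy => ⟨hy.2, by simpa only [Set.mem_preimage, hr hy.1] using hy.1⟩
     left_inv' := fun x hx => hl hx.1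
     right_inv' := fun y hy => hr hy.1
     open_source := hφ.isOpen_inter_preimage hU hV
     open_target := hψ.isOpen_inter_preimage hV hU
     continuousOn_toFun := hφ.mono Set.inter_subset_left
     continuousOn_invFun := hψ.mono Set.inter_subset_left }, ⟨haU, haV⟩, rfl,
    Set.inter_subset_left⟩

open Metric Filter Topology in
/-- A continuous function which is strictly increasing along all lines parallel to `e` can be used
as the coordinate in direction `e`. -/
theorem exists_chart_of_strictMono_on_lines {E : Type*} [NormedAddCommGroup E]
    [InnerProductSpace ℝ E] {F : E → ℝ} {e : E} (he : ‖e‖ = 1) {δ : ℝ} (hδ : 0 < δ)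
    (hF : ContinuousOn F (ball 0 δ))
    (hmono : ∀ (p : E) (t : ℝ), p ∈ ball 0 δ → p + t • e ∈ ball 0 δ → 0 < t → F p < F (p + t • e)) :
    ∃ Ψ : OpenPartialHomeomorph E E, 0 ∈ Ψ.source ∧ Ψ 0 = 0 ∧
      ∀ p ∈ Ψ.source, inner ℝ e (Ψ p) = F p - F 0 := by
  have hee : inner ℝ e e = (1 : ℝ) := by rw [real_inner_self_eq_norm_sq, he, one_pow]
  -- The component along `e` is replaced by `F p - F 0`, and the component orthogonal to `e` is
  -- kept. Strict monotonicity on the lines makes this injective.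
  let ψ : E → E := fun p => p + (F p - F 0 - inner ℝ e p) • e
  have hψe : ∀ p, inner ℝ e (ψ p) = F p - F 0 := fun p => by
    simp only [ψ, inner_add_right, inner_smul_right, hee]; ring
  have hinj : Set.InjOn ψ (ball 0 δ) := by
    intro p hp q hq hpq
    have hFF : F p = F q := by
      have := hψe p
      rw [hpq, hψe q] at this
      linarith
    have hs : ∀ p q : E, F p = F q → ψ p = ψ q → q = p + (inner ℝ e q - inner ℝ e p) • e := by
      intro p q hFF hpq
      simp only [ψ, hFF] at hpq
      linear_combination (norm := module) -hpq
    rcases lt_trichotomy (inner ℝ e p) (inner ℝ e q) with h | h | h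
    · have h1 := hs p q hFF hpq
      have := hmono p (inner ℝ e q - inner ℝ e p) hp (h1 ▸ hq) (sub_pos.2 h)
      rw [← h1] at this
      exact absurd hFF this.ne
    · have h1 := hs p q hFF hpq
      rw [h, sub_self, zero_smul, add_zero] at h1
      exact h1.symm
    · have h1 := hs q p hFF.symm hpq.symm
      have := hmono q (inner ℝ e p - inner ℝ e q) hq (h1 ▸ hp) (sub_pos.2 h)
      rw [← h1] at this
      exact absurd hFF this.ne'
  have hcont : ContinuousOn ψ (ball 0 δ) := by
    have : Continuous fun p : E => (inner ℝ e p : ℝ) := continuous_const.inner continuous_id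
    exact continuousOn_id.add (((hF.sub continuousOn_const).sub this.continuousOn).smul
      continuousOn_const)
  -- Openness comes from the intermediate value theorem. For `q` near `ψ p`, the line through `q`
  -- parallel to `e` is followed near `p`; at the parameters `-t` and `t` the values of `F` lie on
  -- either side of the required one.
  have hnhds : ∀ p ∈ ball (0 : E) δ, ∀ N ∈ 𝓝 p, ψ '' N ∈ 𝓝 (ψ p) := by
    intro p hp N hN
    obtain ⟨ε, hε, hεN⟩ := Metric.mem_nhds_iff.1 (inter_mem hN (isOpen_ball.mem_nhds hp))
    let t := ε / 2
    have ht : 0 < t := by positivity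
    let q₀ : E → E := fun q => q + (inner ℝ e p - inner ℝ e q) • e
    have hq₀c : Continuous q₀ := by
      have : Continuous fun p : E => (inner ℝ e p : ℝ) := continuous_const.inner continuous_id
      exact continuous_id.add ((continuous_const.sub this).smul continuous_const)
    have hq₀p : q₀ (ψ p) = p := by
      simp only [q₀, hψe]; simp only [ψ]; module
    have hmem : ∀ x s, ‖x - p‖ < t → |s| ≤ t → x + s • e ∈ ball p ε := by
      intro x s hx hs
      rw [mem_ball, dist_eq_norm, add_sub_right_comm]
      calc ‖x - p + s • e‖ ≤ ‖x - p‖ + ‖s • e‖ := norm_add_le _ _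
        _ < t + t := by rw [norm_smul, he, mul_one, Real.norm_eq_abs]; linarith
        _ = ε := by simp [t]
    have hpp : ∀ s, |s| ≤ t → p + s • e ∈ ball p ε := fun s hs => hmem p s (by simpa using ht) hs
    have hFat : ∀ x ∈ ball p ε, ContinuousAt F x := fun x hx =>
      hF.continuousAt (isOpen_ball.mem_nhds (hεN hx).2)
    have hm : p + (-t) • e ∈ ball p ε := hpp (-t) (by rw [abs_neg, abs_of_pos ht])
    have hM : p + t • e ∈ ball p ε := hpp t (by rw [abs_of_pos ht])
    have hlt1 : F (p + (-t) • e) < F p := by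
      have h2 : p + (-t) • e + t • e = p := by module
      have := hmono (p + (-t) • e) t (hεN hm).2 (by rwa [h2]) ht
      rwa [h2] at this
    have hlt2 : F p < F (p + t • e) := hmono p t hp (hεN hM).2 ht
    have hc1 : ∀ s, |s| ≤ t → ContinuousAt (fun q => F (q₀ q + s • e)) (ψ p) := by
      intro s hs
      refine ContinuousAt.comp (f := fun q => q₀ q + s • e) ?_ (by fun_prop)
      simp only [hq₀p]
      exact hFat _ (hpp s hs)
    have hc2 : ContinuousAt (fun q : E => (inner ℝ e q : ℝ) + F 0) (ψ p) := by fun_prop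
    have e1 : ∀ᶠ q in 𝓝 (ψ p), ‖q₀ q - p‖ < t := by
      have : ContinuousAt (fun q => ‖q₀ q - p‖) (ψ p) := by fun_prop
      exact this.eventually_lt_const (by simpa [hq₀p] using ht)
    have e2 := (hc1 (-t) (by rw [abs_neg, abs_of_pos ht])).eventually_lt hc2
      (by simpa only [hq₀p, hψe, sub_add_cancel] using hlt1)
    have e3 := hc2.eventually_lt (hc1 t (by rw [abs_of_pos ht]))
      (by simpa only [hq₀p, hψe, sub_add_cancel] using hlt2)
    filter_upwards [e1, e2, e3] with q h1 h2 h3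
    have hcs : ContinuousOn (fun s : ℝ => F (q₀ q + s • e)) (Set.Icc (-t) t) := by
      intro s hs
      have hs' := hmem (q₀ q) s h1 (abs_le.2 hs)
      exact (ContinuousAt.comp (f := fun s : ℝ => q₀ q + s • e) (hFat _ hs')
        (by fun_prop)).continuousWithinAt
    obtain ⟨s, hs, hFs⟩ := intermediate_value_Icc (by linarith) hcs ⟨h2.le, h3.le⟩
    refine ⟨q₀ q + s • e, (hεN (hmem _ s h1 (abs_le.2 hs))).1, ?_⟩
    simp only at hFs
    simp only [ψ, hFs, q₀, inner_add_right, inner_smul_right, hee]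
    module
  have hopen : IsOpenMap ((ball (0 : E) δ).domRestrict ψ) := by
    refine isOpenMap_iff_nhds_le.2 fun p N hN => ?_
    have h1 : Subtype.val '' ((ball (0 : E) δ).domRestrict ψ ⁻¹' N) ∈ 𝓝 (p : E) :=
      isOpen_ball.isOpenMap_subtype_val.image_mem_nhds hN
    refine mem_of_superset (hnhds p p.2 _ h1) ?_
    rintro _ ⟨_, ⟨x, hx, rfl⟩, rfl⟩
    exact hx
  refine ⟨OpenPartialHomeomorph.ofContinuousOpenRestrict hinj.toPartialEquiv hcont hopen isOpen_ball,
    by simpa using hδ, ?_, fun p _ => hψe p⟩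
  change ψ 0 = 0
  simp [ψ]

/-- A unit vector of `ℝⁿ` can be moved to the first basis vector by a linear isometry. -/
theorem exists_linearIsometryEquiv_inner_eq_coord_zero {n : ℕ} {e : EuclideanSpace ℝ (Fin n)}
    (he : ‖e‖ = 1) : ∃ (hn : 0 < n)
      (A : EuclideanSpace ℝ (Fin n) ≃ₗᵢ[ℝ] EuclideanSpace ℝ (Fin n)),
      ∀ p, inner ℝ e (A p) = p ⟨0, hn⟩ := by
  have hn : 0 < n := by
    rcases Nat.eq_zero_or_pos n with rfl | h
    · rw [Subsingleton.elim e 0, norm_zero] at he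
      exact absurd he zero_ne_one
    · exact h
  obtain ⟨b, hb⟩ := Orthonormal.exists_orthonormalBasis_extension_of_card_eq (𝕜 := ℝ)
    (E := EuclideanSpace ℝ (Fin n)) (ι := Fin n) (by simp) (v := fun _ => e) (s := {⟨0, hn⟩})
    ⟨fun i => he, fun i j hij => absurd (Subsingleton.elim i j) hij⟩
  refine ⟨hn, b.repr.symm, fun p => ?_⟩
  rw [← hb _ rfl, ← b.repr_apply_apply, LinearIsometryEquiv.apply_symm_apply]

open Metric Filter Topology in
/-- A function which is strictly increasing along the segments of a local family of lines, running
in directions `e - β P u`, where `P` is the orthogonal projection on a subspace containing `e`,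
is topologically regular. -/
theorem isTopRegularPt_of_strictMono_along {n : ℕ} {f : EuclideanSpace ℝ (Fin n) → ℝ}
    (hf : Continuous f) {z e : EuclideanSpace ℝ (Fin n)} (he : ‖e‖ = 1)
    {S : Submodule ℝ (EuclideanSpace ℝ (Fin n))} (heS : e ∈ S) (β : ℝ) {δ : ℝ} (hδ : 0 < δ)
    (hmono : ∀ (u : EuclideanSpace ℝ (Fin n)) (τ : ℝ), 0 < τ → τ * β < 1 → ‖u‖ < δ →
      ‖u + τ • (e - β • S.starProjection u)‖ < δ →
      f (z + u) < f (z + (u + τ • (e - β • S.starProjection u)))) :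
    IsTopRegularPt f z := by
  set P := S.starProjection with hP
  have hPP : ∀ x, P (P x) = P x := fun x =>
    Submodule.starProjection_eq_self_iff.2 (Submodule.starProjection_apply_mem S x)
  have hPe : P e = e := Submodule.starProjection_eq_self_iff.2 heS
  have hin : ∀ x, inner ℝ e (P x) = (inner ℝ e x : ℝ) := fun x => by
    rw [← Submodule.inner_starProjection_left_eq_right, ← hP, hPe]
  have hee : inner ℝ e e = (1 : ℝ) := by rw [real_inner_self_eq_norm_sq, he, one_pow]
  -- `φ` scales by `κ` the part of `P p` orthogonal to `e` and keeps the rest. It carries a line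
  -- parallel to `e` to a line through `φ p` with direction `e - β • P (φ p)`. As `κ` depends only
  -- on the preserved coordinate along `e`, the inverse `ψ` scales by the inverse factor.
  let κ : EuclideanSpace ℝ (Fin n) → ℝ := fun p => 1 - β * inner ℝ e p
  let φ : EuclideanSpace ℝ (Fin n) → EuclideanSpace ℝ (Fin n) :=
    fun p => p + (κ p - 1) • (P p - (inner ℝ e p : ℝ) • e)
  let ψ : EuclideanSpace ℝ (Fin n) → EuclideanSpace ℝ (Fin n) :=
    fun u => u + ((κ u)⁻¹ - 1) • (P u - (inner ℝ e u : ℝ) • e)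
  have hκc : Continuous κ := by fun_prop
  have hφc : Continuous φ := by fun_prop
  have hφe : ∀ p, (inner ℝ e (φ p) : ℝ) = inner ℝ e p := fun p => by
    simp only [φ, inner_add_right, inner_smul_right, inner_sub_right, hee, hin]; ring
  have hψe : ∀ p, (inner ℝ e (ψ p) : ℝ) = inner ℝ e p := fun p => by
    simp only [ψ, inner_add_right, inner_smul_right, inner_sub_right, hee, hin]; ring
  have hφκ : ∀ p, κ (φ p) = κ p := fun p => by simp only [κ, hφe]
  have hψκ : ∀ p, κ (ψ p) = κ p := fun p => by simp only [κ, hψe]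
  have hPφ : ∀ p, P (φ p) = P p + (κ p - 1) • (P p - (inner ℝ e p : ℝ) • e) := fun p => by
    simp only [φ, map_add, map_smul, map_sub, hPP, hPe]
  have hPψ : ∀ p, P (ψ p) = P p + ((κ p)⁻¹ - 1) • (P p - (inner ℝ e p : ℝ) • e) := fun p => by
    simp only [ψ, map_add, map_smul, map_sub, hPP, hPe]
  let U : Set (EuclideanSpace ℝ (Fin n)) := {p | κ p ≠ 0}
  have hU : IsOpen U := isOpen_ne_fun hκc continuous_const
  have h0U : (0 : EuclideanSpace ℝ (Fin n)) ∈ U := by simp [U, κ]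
  have hφ0 : φ 0 = 0 := by simp [φ]
  have hψc : ContinuousOn ψ U := by
    have h1 : ContinuousOn (fun u => (κ u)⁻¹) U := hκc.continuousOn.inv₀ fun u hu => hu
    have h2 : Continuous fun u => P u - (inner ℝ e u : ℝ) • e := by fun_prop
    exact continuousOn_id.add ((h1.sub continuousOn_const).smul h2.continuousOn)
  obtain ⟨Φ, h0Φ, hΦ, -⟩ := exists_openPartialHomeomorph_of_leftInvOn (φ := φ) (ψ := ψ) hU hU
    hφc.continuousOn hψc h0U (by rwa [hφ0])
    (fun p hp => by
      have hp' : κ p ≠ 0 := hp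
      simp only [ψ, hφκ, hPφ, hφe]
      simp only [φ]
      match_scalars <;> field_simp <;> ring)
    (fun p hp => by
      have hp' : κ p ≠ 0 := hp
      simp only [φ, hψκ, hPψ, hψe]
      simp only [ψ]
      match_scalars <;> field_simp <;> ring)
  obtain ⟨r, hr, hrs⟩ : ∃ r > 0, ∀ p ∈ ball (0 : EuclideanSpace ℝ (Fin n)) r,
      ‖φ p‖ < δ ∧ 0 < κ p := by
    have h1 : ∀ᶠ p in 𝓝 0, ‖φ p‖ < δ :=
      hφc.norm.continuousAt.eventually_lt_const (by simpa [hφ0] using hδ)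
    have h2 : ∀ᶠ p in 𝓝 0, 0 < κ p :=
      hκc.continuousAt.eventually_const_lt (by simp [κ])
    obtain ⟨r, hr, h⟩ := Metric.eventually_nhds_iff_ball.1 (h1.and h2)
    exact ⟨r, hr, h⟩
  obtain ⟨Ψ, h0Ψ, hΨ0, hΨ⟩ := exists_chart_of_strictMono_on_lines (F := fun p => f (z + φ p)) he hr
    (by fun_prop) (fun p t hp hpt ht => by
      obtain ⟨hp1, hp2⟩ := hrs p hp
      obtain ⟨hq1, hq2⟩ := hrs _ hpt
      have hκt : κ (p + t • e) = κ p - β * t := by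
        simp only [κ, inner_add_right, inner_smul_right, hee]; ring
      rw [hκt] at hq2
      -- The parameter changes from `t` to `t / κ p`; the condition `τ * β < 1` then amounts to `κ
      -- (p + t • e) > 0`.
      have hφt : φ (p + t • e) = φ p + (t / κ p) • (e - β • P (φ p)) := by
        rw [hPφ]
        simp only [φ, hκt, map_add, map_smul, hPe, inner_add_right, inner_smul_right, hee]
        have hk : κ p = 1 - β * inner ℝ e p := rfl
        have hne := hp2.ne'
        match_scalars
        · field_simp
        · field_simp
          rw [hk]; ring
        · field_simp
          rw [hk]; ring
      have hlt := hmono (φ p) (t / κ p) (by positivity)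
        (by rw [div_mul_eq_mul_div, div_lt_one hp2]; linarith) hp1 (by rwa [← hφt])
      simpa only [hφt] using hlt)
  obtain ⟨hn, A, hA⟩ := exists_linearIsometryEquiv_inner_eq_coord_zero he
  have hs0 : Ψ.symm 0 = 0 := by
    conv_lhs => rw [← hΨ0]
    exact Ψ.left_inv h0Ψ
  have h0t : (0 : EuclideanSpace ℝ (Fin n)) ∈ Ψ.target := by
    have := Ψ.map_source h0Ψ
    rwa [hΨ0] at this
  refine ⟨hn, A.toHomeomorph.transOpenPartialHomeomorph
    ((Ψ.symm.trans Φ).transHomeomorph (Homeomorph.addLeft z)), ?_, ?_, fun p hp => ?_⟩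
  · simp [h0t, hs0, h0Φ]
  · simp [hs0, hΦ, hφ0]
  · have hp' : A p ∈ Ψ.target := by
      simp only [OpenPartialHomeomorph.trans_source, OpenPartialHomeomorph.symm_source,
        Homeomorph.transOpenPartialHomeomorph_source,
        OpenPartialHomeomorph.transHomeomorph_source, Set.mem_preimage, Set.mem_inter_iff] at hp
      exact hp.1
    have h1 := hΨ _ (Ψ.map_target hp')
    rw [Ψ.right_inv hp', hA, hφ0, add_zero] at h1
    have h2 : (A.toHomeomorph.transOpenPartialHomeomorph
      ((Ψ.symm.trans Φ).transHomeomorph (Homeomorph.addLeft z))) p = z + φ (Ψ.symm (A p)) := by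
      rw [← hΦ]; rfl
    rw [h2]
    linarith

end Charts

/-! ### Support functions of finite sets -/

section MaxInner

variable {E : Type*} [NormedAddCommGroup E] [InnerProductSpace ℝ E]

/-- The support function of a nonempty finite set of vectors. -/
noncomputable def maxInner (P : Finset E) (hP : P.Nonempty) (u : E) : ℝ :=
  P.sup' hP fun a => inner ℝ u a

variable {P : Finset E} {hP : P.Nonempty}

theorem inner_le_maxInner {a : E} (ha : a ∈ P) (u : E) : inner ℝ u a ≤ maxInner P hP u :=
  Finset.le_sup' (fun a => (inner ℝ u a : ℝ)) ha

theorem exists_maxInner_eq (hP : P.Nonempty) (u : E) :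
    ∃ a ∈ P, maxInner P hP u = inner ℝ u a :=
  Finset.exists_mem_eq_sup' hP _

theorem maxInner_add_le (u v : E) :
    maxInner P hP (u + v) ≤ maxInner P hP u + maxInner P hP v := by
  obtain ⟨a, ha, h⟩ := exists_maxInner_eq hP (u + v)
  rw [h, inner_add_left]
  exact add_le_add (inner_le_maxInner ha u) (inner_le_maxInner ha v)

theorem maxInner_smul {t : ℝ} (ht : 0 ≤ t) (u : E) :
    maxInner P hP (t • u) = t * maxInner P hP u := by
  apply le_antisymm
  · obtain ⟨a, ha, h⟩ := exists_maxInner_eq hP (t • u)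
    rw [h, real_inner_smul_left]
    exact mul_le_mul_of_nonneg_left (inner_le_maxInner ha u) ht
  · obtain ⟨a, ha, h⟩ := exists_maxInner_eq hP u
    rw [h, ← real_inner_smul_left]
    exact inner_le_maxInner ha _

@[simp]
theorem maxInner_zero : maxInner P hP 0 = 0 := by
  simpa using maxInner_smul (hP := hP) le_rfl (0 : E)

theorem continuous_maxInner (hP : P.Nonempty) : Continuous (maxInner P hP) :=
  Continuous.finset_sup'_apply hP fun _ _ => continuous_id.inner continuous_const

/-- The projection is self-adjoint and fixes `P`. Thus the support function sees only the component
in `S`, which decouples `S` from its orthogonal complement. -/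
theorem maxInner_starProjection {S : Submodule ℝ E} [S.HasOrthogonalProjection]
    (hS : ∀ a ∈ P, a ∈ S) (u : E) : maxInner P hP (S.starProjection u) = maxInner P hP u := by
  refine Finset.sup'_congr hP rfl fun a ha => ?_
  rw [Submodule.inner_starProjection_left_eq_right,
    Submodule.starProjection_eq_self_iff.2 (hS a ha)]

theorem eq_zero_of_mem_span_of_inner_eq_zero {P : Set E} {w : E} (hw : w ∈ Submodule.span ℝ P)
    (h : ∀ a ∈ P, inner ℝ w a = (0 : ℝ)) : w = 0 := by
  have : ∀ x ∈ Submodule.span ℝ P, inner ℝ w x = (0 : ℝ) := by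
    intro x hx
    induction hx using Submodule.span_induction with
    | mem x hx => exact h x hx
    | zero => exact inner_zero_right _
    | add x y _ _ hx hy => rw [inner_add_right, hx, hy, add_zero]
    | smul t x _ hx => rw [inner_smul_right, hx, mul_zero]
  exact inner_self_eq_zero.1 (this w hw)

/-- If some nonzero vector of the span of `P` makes nonacute angles with all vectors of `P`, then
one of them makes acute angles with all the others. -/
theorem exists_unit_inner_pos_of_maxInner_nonpos [FiniteDimensional ℝ E] {v : E}
    (hvS : v ∈ Submodule.span ℝ (P : Set E)) (hv0 : v ≠ 0) (hv : maxInner P hP v ≤ 0) :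
    ∃ e ∈ Submodule.span ℝ (P : Set E), ‖e‖ = 1 ∧ maxInner P hP e ≤ 0 ∧
      ∀ w ∈ Submodule.span ℝ (P : Set E), w ≠ 0 → maxInner P hP w ≤ 0 → 0 < (inner ℝ w e : ℝ) := by
  set S := Submodule.span ℝ (P : Set E) with hS
  let C : Set E := {w | w ∈ S ∧ maxInner P hP w ≤ 0}
  have hCc : IsClosed C := (Submodule.closed_of_finiteDimensional S).inter
    (isClosed_le (continuous_maxInner hP) continuous_const)
  have hadd : ∀ x ∈ C, ∀ y ∈ C, x + y ∈ C := fun x hx y hy =>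
    ⟨S.add_mem hx.1 hy.1, (maxInner_add_le x y).trans (add_nonpos hx.2 hy.2)⟩
  have hsmul : ∀ x ∈ C, ∀ t : ℝ, 0 ≤ t → t • x ∈ C := fun x hx t ht =>
    ⟨S.smul_mem t hx.1, by rw [maxInner_smul ht]; exact mul_nonpos_of_nonneg_of_nonpos ht hx.2⟩
  have hconv : Convex ℝ C := fun x hx y hy a b ha hb _ =>
    hadd _ (hsmul x hx a ha) _ (hsmul y hy b hb)
  -- `e` is the point of the cone `C` nearest to b = -∑ a. Testing the variational inequality at `e
  -- + w` gives ⟨w, e⟩ ≥ ⟨b, w⟩ = -∑ ⟨a, w⟩, which is positive for nonzero `w` in `C`: no term ⟨a,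
  -- w⟩ is positive, and they cannot all vanish because `P` spans `S`.
  obtain ⟨e, heC, he⟩ := exists_norm_eq_iInf_of_complete_convex (K := C) ⟨v, hvS, hv⟩ hCc.isComplete hconv
    (-∑ a ∈ P, a)
  rw [norm_eq_iInf_iff_real_inner_le_zero hconv heC] at he
  have hpos : ∀ w ∈ C, w ≠ 0 → 0 < (inner ℝ w e : ℝ) := by
    intro w hw hw0
    have h1 := he _ (hadd e heC w hw)
    rw [add_sub_cancel_left, inner_sub_left, inner_neg_left, sum_inner] at h1
    have hle : ∀ a ∈ P, (inner ℝ a w : ℝ) ≤ 0 := fun a ha => by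
      rw [real_inner_comm]; exact (inner_le_maxInner ha w).trans hw.2
    have h2 : ∑ a ∈ P, (inner ℝ a w : ℝ) < 0 := by
      refine Finset.sum_neg' hle ?_
      by_contra! hcon
      exact hw0 (eq_zero_of_mem_span_of_inner_eq_zero hw.1 fun a ha => by
        rw [real_inner_comm]; exact le_antisymm (hle a ha) (hcon a ha))
    rw [real_inner_comm]
    linarith
  have he0 : e ≠ 0 := fun h => by
    have := hpos v ⟨hvS, hv⟩ hv0
    rw [h, inner_zero_right] at this
    exact lt_irrefl _ this
  have hn : 0 < ‖e‖ := norm_pos_iff.2 he0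
  have heC' := hsmul e heC ‖e‖⁻¹ (by positivity)
  refine ⟨‖e‖⁻¹ • e, heC'.1, norm_smul_inv_norm he0, heC'.2, fun w hwS hw0 hw => ?_⟩
  rw [real_inner_smul_right]
  exact mul_pos (by positivity) (hpos w ⟨hwS, hw⟩ hw0)

end MaxInner

/-! ### Local form and regular points of the distance function -/

section Distance

variable {n : ℕ} {X : Set (EuclideanSpace ℝ (Fin n))} {z : EuclideanSpace ℝ (Fin n)}
  {P : Finset (EuclideanSpace ℝ (Fin n))} {hP : P.Nonempty}

open Filter Topology in
/-- Near `z`, the squared distance to a finite set is governed by the nearest points of `z`. -/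
theorem exists_finset_sq_infDist_eq (hX : X.Finite) (hX0 : X.Nonempty)
    (z : EuclideanSpace ℝ (Fin n)) :
    ∃ (P : Finset (EuclideanSpace ℝ (Fin n))) (hP : P.Nonempty),
      (P : Set (EuclideanSpace ℝ (Fin n))) = (fun x => x - z) '' nearestPts X z ∧
      ∃ R > 0, ∀ u, ‖u‖ < R → Metric.infDist (z + u) X ^ 2 =
        Metric.infDist z X ^ 2 + ‖u‖ ^ 2 - 2 * maxInner P hP u := by
  classical
  have hfin : ((fun x => x - z) '' nearestPts X z).Finite :=
    (hX.subset fun x hx => hx.1).image _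
  obtain ⟨x₀, hx₀X, hx₀⟩ := hX.isCompact.exists_infDist_eq_dist hX0 z
  have hne : hfin.toFinset.Nonempty := ⟨x₀ - z, by
    simp only [Set.Finite.mem_toFinset]
    exact ⟨x₀, ⟨hx₀X, hx₀.symm⟩, rfl⟩⟩
  refine ⟨hfin.toFinset, hne, by simp, ?_⟩
  -- By continuity and finiteness, a point of `X` that is not nearest to `z` stays farther than `x₀`
  -- for small `u`, so a nearest point of `z + u` is already a nearest point of `z`.
  have hev : ∀ᶠ u in 𝓝 (0 : EuclideanSpace ℝ (Fin n)), ∀ x ∈ X,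
      x ∉ nearestPts X z → dist (z + u) x₀ < dist (z + u) x := by
    rw [eventually_all_finite hX]
    intro x hx
    by_cases hxn : x ∈ nearestPts X z
    · exact Eventually.of_forall fun u h => absurd hxn h
    · have hlt : dist z x₀ < dist z x := by
        rw [← hx₀]
        exact lt_of_le_of_ne (Metric.infDist_le_dist_of_mem hx) fun h => hxn ⟨hx, h.symm⟩
      have h1 : ContinuousAt (fun u : EuclideanSpace ℝ (Fin n) => dist (z + u) x₀) 0 := by fun_prop
      have h2 : ContinuousAt (fun u : EuclideanSpace ℝ (Fin n) => dist (z + u) x) 0 := by fun_prop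
      filter_upwards [h1.eventually_lt h2 (by simpa using hlt)] with u hu _ using hu
  obtain ⟨R, hR, hRu⟩ := Metric.eventually_nhds_iff.1 hev
  refine ⟨R, hR, fun u hu => ?_⟩
  have hsq : ∀ x ∈ nearestPts X z, dist (z + u) x ^ 2 =
      Metric.infDist z X ^ 2 + ‖u‖ ^ 2 - 2 * inner ℝ u (x - z) := by
    intro x hx
    rw [← hx.2, dist_eq_norm, dist_eq_norm, show z + u - x = u - (x - z) by abel,
      norm_sub_sq_real, norm_sub_rev z x]
    ring
  obtain ⟨x₁, hx₁X, hx₁⟩ := hX.isCompact.exists_infDist_eq_dist hX0 (z + u)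
  have hx₁n : x₁ ∈ nearestPts X z := by
    by_contra hcon
    have := hRu (y := u) (by simpa using hu) x₁ hx₁X hcon
    rw [← hx₁] at this
    exact absurd (Metric.infDist_le_dist_of_mem hx₀X) (not_le.2 this)
  apply le_antisymm
  · obtain ⟨a, ha, h⟩ := exists_maxInner_eq hne u
    simp only [Set.Finite.mem_toFinset] at ha
    obtain ⟨x, hx, rfl⟩ := ha
    rw [h, ← hsq x hx]
    exact pow_le_pow_left₀ Metric.infDist_nonneg (Metric.infDist_le_dist_of_mem hx.1) 2
  · rw [hx₁, hsq x₁ hx₁n]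
    have := inner_le_maxInner (P := hfin.toFinset) (hP := hne) (a := x₁ - z)
      (by simp only [Set.Finite.mem_toFinset]; exact ⟨x₁, hx₁n, rfl⟩) u
    linarith

/-- A criterion for topological regularity of the distance function. -/
theorem isTopRegularPt_infDist_of_nonneg {R : ℝ} (hR : 0 < R)
    (hloc : ∀ u, ‖u‖ < R → Metric.infDist (z + u) X ^ 2 =
      Metric.infDist z X ^ 2 + ‖u‖ ^ 2 - 2 * maxInner P hP u)
    {S : Submodule ℝ (EuclideanSpace ℝ (Fin n))} (hPS : ∀ a ∈ P, a ∈ S)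
    {e : EuclideanSpace ℝ (Fin n)} (heS : e ∈ S) (he : ‖e‖ = 1) {β δ : ℝ} (hβ : 0 ≤ β) (hδ : 0 < δ)
    (hnn : ∀ s ∈ S, ‖s‖ < δ →
      0 ≤ inner ℝ s e - β * ‖s‖ ^ 2 + β * maxInner P hP s - maxInner P hP e) :
    IsTopRegularPt (fun y => Metric.infDist y X) z := by
  -- The quantity in `hnn` bounds from below half the rate of growth of the squared distance along
  -- `e - β • s`. Strictness comes from the term in τ², which needs `e - β • s ≠ 0`; the radius `1 /
  -- (β + 1)` gives β‖s‖ < 1 = ‖e‖.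
  refine isTopRegularPt_of_strictMono_along (Metric.continuous_infDist_pt X) he heS β
    (δ := min (min δ R) (1 / (β + 1))) (by positivity) fun u τ hτ hτβ hu huV => ?_
  have hPe : S.starProjection e = e := Submodule.starProjection_eq_self_iff.2 heS
  set s := S.starProjection u with hs
  have hsS : s ∈ S := Submodule.starProjection_apply_mem S u
  have hPs : S.starProjection s = s := Submodule.starProjection_eq_self_iff.2 hsS
  have hsu : ‖s‖ ≤ ‖u‖ := Submodule.norm_starProjection_apply_le S u
  have hu1 : ‖u‖ < δ := hu.trans_le ((min_le_left _ _).trans (min_le_left _ _))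
  have hu2 : ‖u‖ < R := hu.trans_le ((min_le_left _ _).trans (min_le_right _ _))
  have hu3 : ‖u‖ < 1 / (β + 1) := hu.trans_le (min_le_right _ _)
  have hV2 : ‖u + τ • (e - β • s)‖ < R := huV.trans_le ((min_le_left _ _).trans (min_le_right _ _))
  refine lt_of_pow_lt_pow_left₀ 2 Metric.infDist_nonneg ?_
  rw [hloc u hu2, hloc _ hV2]
  -- Within `S`, the moved point is `(1 - τβ) s + τ e`, with nonnegative coefficients because `τ * β
  -- < 1`, so sublinearity applies.
  have hmax : maxInner P hP (u + τ • (e - β • s)) ≤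
      (1 - τ * β) * maxInner P hP u + τ * maxInner P hP e := by
    rw [← maxInner_starProjection hPS, map_add, map_smul, map_sub, map_smul, hPe, hPs, ← hs,
      show s + τ • (e - β • s) = (1 - τ * β) • s + τ • e by module]
    refine (maxInner_add_le _ _).trans ?_
    rw [maxInner_smul (by linarith), maxInner_smul hτ.le, hs, maxInner_starProjection hPS]
  have hVne : e - β • s ≠ 0 := by
    intro h0
    have h1 : e = β • s := sub_eq_zero.1 h0
    have h2 : ‖e‖ = β * ‖s‖ := by rw [h1, norm_smul, Real.norm_of_nonneg hβ]
    rw [lt_div_iff₀ (by positivity)] at hu3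
    nlinarith [norm_nonneg u, norm_nonneg s]
  have hVpos : 0 < ‖e - β • s‖ ^ 2 := by
    have := norm_pos_iff.2 hVne
    positivity
  have hnorm : ‖u + τ • (e - β • s)‖ ^ 2 = ‖u‖ ^ 2 +
      2 * τ * (inner ℝ s e - β * ‖s‖ ^ 2) + τ ^ 2 * ‖e - β • s‖ ^ 2 := by
    have h1 : (inner ℝ u e : ℝ) = inner ℝ s e := by
      rw [hs, Submodule.inner_starProjection_left_eq_right, hPe]
    have h2 : (inner ℝ u s : ℝ) = ‖s‖ ^ 2 := by
      rw [← real_inner_self_eq_norm_sq]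
      conv_rhs => rw [hs]
      rw [Submodule.inner_starProjection_left_eq_right, ← hs, hPs]
    rw [norm_add_sq_real, norm_smul, Real.norm_of_nonneg hτ.le, inner_smul_right, inner_sub_right,
      inner_smul_right, h1, h2]
    ring
  have hb := hnn s hsS (hsu.trans_lt hu1)
  rw [hs, maxInner_starProjection hPS, ← hs] at hb
  rw [hnorm]
  nlinarith [mul_nonneg hτ.le hb, mul_pos (pow_pos hτ 2) hVpos]

/-- Points outside of the convex hull of their nearest points are topologically regular for the
distance function. -/
theorem isTopRegularPt_infDist_of_notMem_convexHull (hX : X.Finite) (hX0 : X.Nonempty)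
    (hz : z ∉ convexHull ℝ (nearestPts X z)) :
    IsTopRegularPt (fun y => Metric.infDist y X) z := by
  obtain ⟨P, hP, hPX, R, hR, hloc⟩ := exists_finset_sq_infDist_eq hX hX0 z
  have hfin : (nearestPts X z).Finite := hX.subset fun x hx => hx.1
  obtain ⟨g, t, hgz, hgt⟩ := geometric_hahn_banach_point_closed (convex_convexHull ℝ _)
    (hfin.isClosed_convexHull (𝕜 := ℝ)) hz
  let v := -(InnerProductSpace.toDual ℝ (EuclideanSpace ℝ (Fin n))).symm g
  have hv : maxInner P hP v < 0 := by
    obtain ⟨a, ha, h⟩ := exists_maxInner_eq hP v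
    rw [h, inner_neg_left, InnerProductSpace.toDual_symm_apply]
    obtain ⟨x, hx, rfl⟩ : a ∈ (fun x => x - z) '' nearestPts X z := hPX ▸ ha
    have := hgt x (subset_convexHull ℝ _ hx)
    rw [map_sub]
    linarith
  have hv0 : v ≠ 0 := fun h => by rw [h, maxInner_zero] at hv; exact lt_irrefl _ hv
  have hn : 0 < ‖v‖⁻¹ := inv_pos.2 (norm_pos_iff.2 hv0)
  have he : maxInner P hP (‖v‖⁻¹ • v) < 0 := by
    rw [maxInner_smul hn.le]
    exact mul_neg_of_pos_of_neg hn hv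
  have he1 : ‖‖v‖⁻¹ • v‖ = 1 := norm_smul_inv_norm hv0
  -- With β = 0 the lines are parallel, and for ‖s‖ below -h(e) the term ⟨s, e⟩ cannot outweigh
  -- -h(e).
  refine isTopRegularPt_infDist_of_nonneg hR hloc (S := ⊤) (fun _ _ => trivial)
    (e := ‖v‖⁻¹ • v) trivial he1 le_rfl (neg_pos.2 he) fun s _ hs => ?_
  have h1 := neg_le_of_abs_le (abs_real_inner_le_norm s (‖v‖⁻¹ • v))
  rw [he1, mul_one] at h1
  linarith

theorem nearestSpan_eq_span
    (hPX : (P : Set (EuclideanSpace ℝ (Fin n))) = (fun x => x - z) '' nearestPts X z) :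
    nearestSpan X z = Submodule.span ℝ (P : Set (EuclideanSpace ℝ (Fin n))) := by
  rw [hPX]; rfl

/-- The half-space of all `x` with ⟨u, x - z⟩ ≤ `maxInner P hP u` contains the nearest points, hence
their hull and in particular `z`. -/
theorem maxInner_nonneg_of_mem_convexHull
    (hPX : (P : Set (EuclideanSpace ℝ (Fin n))) = (fun x => x - z) '' nearestPts X z)
    (hz : z ∈ convexHull ℝ (nearestPts X z)) (u : EuclideanSpace ℝ (Fin n)) :
    0 ≤ maxInner P hP u := by
  have hsub : nearestPts X z ⊆ {x | inner ℝ u x ≤ maxInner P hP u + inner ℝ u z} := by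
    intro x hx
    have ha : x - z ∈ P := by
      rw [← Finset.mem_coe, hPX]; exact ⟨x, hx, rfl⟩
    have := inner_le_maxInner (hP := hP) ha u
    rw [inner_sub_right] at this
    exact sub_le_iff_le_add.1 this
  have hmem := convexHull_min hsub
    (convex_halfSpace_le ⟨fun x y => inner_add_right u x y, fun c x => real_inner_smul_right u x c⟩
      _) hz
  simpa using hmem

/-- A point of the convex hull of its nearest points whose convex hull has it on its relative
boundary is topologically regular for the distance function. -/
theorem isTopRegularPt_infDist_of_mem_convexHull (hX : X.Finite) (hX0 : X.Nonempty)
    (hz : z ∈ convexHull ℝ (nearestPts X z))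
    (h : ∃ v ∈ nearestSpan X z, v ≠ 0 ∧ ∀ x ∈ nearestPts X z, inner ℝ v (x - z) ≤ (0 : ℝ)) :
    IsTopRegularPt (fun y => Metric.infDist y X) z := by
  obtain ⟨P, hP, hPX, R, hR, hloc⟩ := exists_finset_sq_infDist_eq hX hX0 z
  obtain ⟨v, hvS, hv0, hv⟩ := h
  rw [nearestSpan_eq_span hPX] at hvS
  have hnn := maxInner_nonneg_of_mem_convexHull (hP := hP) hPX hz
  have hvm : maxInner P hP v ≤ 0 := by
    obtain ⟨a, ha, h⟩ := exists_maxInner_eq hP v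
    obtain ⟨x, hx, rfl⟩ : a ∈ (fun x => x - z) '' nearestPts X z := hPX ▸ ha
    rw [h]; exact hv x hx
  obtain ⟨e, heS, he, heh, hepos⟩ := exists_unit_inner_pos_of_maxInner_nonpos hvS hv0 hvm
  set S := Submodule.span ℝ (P : Set (EuclideanSpace ℝ (Fin n))) with hS
  -- a uniform lower bound on the unit sphere of `S`
  obtain ⟨κ, hκ, hκmin⟩ : ∃ κ > 0, ∀ u ∈ S, ‖u‖ = 1 →
      κ ≤ max (maxInner P hP u) (inner ℝ u e) := by
    have hK : IsCompact (Metric.sphere 0 1 ∩ (S : Set (EuclideanSpace ℝ (Fin n)))) :=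
      (isCompact_sphere 0 1).inter_right (Submodule.closed_of_finiteDimensional S)
    obtain ⟨u₀, hu₀, hmin⟩ := hK.exists_isMinOn ⟨e, by simpa using he, heS⟩
      (f := fun u => max (maxInner P hP u) (inner ℝ u e))
      (((continuous_maxInner hP).max (continuous_id.inner continuous_const)).continuousOn)
    refine ⟨_, ?_, fun u hu hu1 => hmin ⟨by simpa using hu1, hu⟩⟩
    -- The minimum is positive: where the support function is not positive, the choice of `e` makes
    -- the inner product positive.
    rcases lt_or_ge 0 (maxInner P hP u₀) with h | h
    · exact lt_max_of_lt_left h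
    · refine lt_max_of_lt_right (hepos u₀ hu₀.2 (fun h0 => ?_) h)
      have := hu₀.1
      simp [h0] at this
  -- If the support function is at least κ, then β = 2/κ contributes at least 2, against ⟨u, e⟩ ≥
  -- -1. Otherwise ⟨u, e⟩ ≥ κ and the other term is nonnegative.
  have hmain : ∀ u ∈ S, ‖u‖ = 1 → min 1 κ ≤ inner ℝ u e + 2 / κ * maxInner P hP u := by
    intro u hu hu1
    rcases le_max_iff.1 (hκmin u hu hu1) with h | h
    · have h1 := neg_le_of_abs_le (abs_real_inner_le_norm u e)
      rw [hu1, he, mul_one] at h1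
      have h2 : 2 / κ * κ ≤ 2 / κ * maxInner P hP u := by gcongr
      rw [div_mul_cancel₀ _ hκ.ne'] at h2
      linarith [min_le_left 1 κ]
    · have : 0 ≤ 2 / κ * maxInner P hP u := mul_nonneg (by positivity) (hnn u)
      linarith [min_le_right 1 κ]
  -- The choice of δ makes β‖s‖² at most min(1, κ)‖s‖, the lower bound obtained from `hmain` by
  -- homogeneity.
  refine isTopRegularPt_infDist_of_nonneg hR hloc (S := S) (fun a ha => Submodule.subset_span ha)
    heS he (β := 2 / κ) (δ := min 1 κ / (2 / κ)) (by positivity) (by positivity) fun s hs hsδ => ?_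
  rcases eq_or_ne s 0 with rfl | hs0
  · simpa using heh
  · have hr : 0 < ‖s‖ := norm_pos_iff.2 hs0
    have h1 := hmain (‖s‖⁻¹ • s) (S.smul_mem _ hs) (norm_smul_inv_norm hs0)
    rw [real_inner_smul_left, maxInner_smul (by positivity)] at h1
    rw [lt_div_iff₀ (by positivity)] at hsδ
    have h2 := mul_le_mul_of_nonneg_left h1 hr.le
    have h3 : ‖s‖ * (‖s‖⁻¹ * inner ℝ s e + 2 / κ * (‖s‖⁻¹ * maxInner P hP s)) =
        inner ℝ s e + 2 / κ * maxInner P hP s := by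
      field_simp
    rw [h3] at h2
    nlinarith

end Distance

/-! ### Saddles are not topologically regular -/

section NonRegular

open Filter Topology in
/-- A point which is a strict local maximum of `f` along `S` and a local minimum of `f` along the
orthogonal complement of `S` is not topologically regular. -/
theorem not_isTopRegularPt_of_saddle {n : ℕ} {f : EuclideanSpace ℝ (Fin n) → ℝ}
    {z : EuclideanSpace ℝ (Fin n)} {S : Submodule ℝ (EuclideanSpace ℝ (Fin n))} {R : ℝ}
    (hR : 0 < R) (hmax : ∀ s ∈ S, s ≠ 0 → ‖s‖ < R → f (z + s) < f z)
    (hmin : ∀ w ∈ Sᗮ, ‖w‖ < R → f z ≤ f (z + w)) : ¬ IsTopRegularPt f z := by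
  rintro ⟨hn, φ, h0, hφ0, hφ⟩
  let e : EuclideanSpace ℝ (Fin n) := EuclideanSpace.single ⟨0, hn⟩ 1
  -- In the hypothetical chart, `ξ (u, t)` is `z + u` pushed down so that `f` drops by exactly `t`.
  let ξ : EuclideanSpace ℝ (Fin n) × ℝ → EuclideanSpace ℝ (Fin n) :=
    fun q => φ.symm (z + q.1) - q.2 • e
  have hzt : z ∈ φ.target := by rw [← hφ0]; exact φ.map_source h0
  have hsz : φ.symm z = 0 := by rw [← hφ0]; exact φ.left_inv h0
  have hξc : ∀ q, z + q.1 ∈ φ.target → ContinuousAt ξ q := fun q hq => by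
    have h1 : ContinuousAt (fun q : EuclideanSpace ℝ (Fin n) × ℝ => φ.symm (z + q.1)) q :=
      ContinuousAt.comp (f := fun q : EuclideanSpace ℝ (Fin n) × ℝ => z + q.1)
        (φ.continuousAt_symm hq) (by fun_prop)
    exact h1.sub (by fun_prop)
  have hξ0 : ξ (0, 0) = 0 := by simp [ξ, hsz]
  have hηc : ∀ q, z + q.1 ∈ φ.target → ξ q ∈ φ.source → ContinuousAt (fun q => φ (ξ q) - z) q :=
    fun q hq hq' => (ContinuousAt.comp (φ.continuousAt hq') (hξc q hq)).sub continuousAt_const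
  have hev : ∀ᶠ q : EuclideanSpace ℝ (Fin n) × ℝ in 𝓝 (0, 0),
      z + q.1 ∈ φ.target ∧ ξ q ∈ φ.source ∧ ‖φ (ξ q) - z‖ < R := by
    have h1 : ∀ᶠ q : EuclideanSpace ℝ (Fin n) × ℝ in 𝓝 (0, 0), z + q.1 ∈ φ.target :=
      (show ContinuousAt (fun q : EuclideanSpace ℝ (Fin n) × ℝ => z + q.1) (0, 0) by
        fun_prop).eventually_mem (φ.open_target.mem_nhds (by simpa using hzt))
    have hz0 : z + (0, (0 : ℝ)).1 ∈ φ.target := by simpa using hzt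
    have h2 : ∀ᶠ q in 𝓝 (0, 0), ξ q ∈ φ.source :=
      (hξc (0, 0) hz0).eventually_mem (φ.open_source.mem_nhds (by rwa [hξ0]))
    have h3 : ∀ᶠ q in 𝓝 (0, 0), ‖φ (ξ q) - z‖ < R :=
      (hηc (0, 0) hz0 (by rwa [hξ0])).norm.eventually_lt_const (by simpa [hξ0, hφ0] using hR)
    exact h1.and (h2.and h3)
  obtain ⟨ε, hε, hball⟩ := Metric.eventually_nhds_iff.1 hev
  let ρ := min (ε / 2) (R / 2)
  have hρ : 0 < ρ := by positivity
  have hρε : ρ < ε := (min_le_left _ _).trans_lt (half_lt_self hε)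
  have hρR : ρ < R := (min_le_right _ _).trans_lt (half_lt_self hR)
  have hD : ∀ u : EuclideanSpace ℝ (Fin n), ‖u‖ ≤ ρ → z + u ∈ φ.target ∧
      ξ (u, ρ - ‖u‖) ∈ φ.source ∧ ‖φ (ξ (u, ρ - ‖u‖)) - z‖ < R := by
    intro u hu
    refine hball (y := (u, ρ - ‖u‖)) ?_
    rw [dist_eq_norm, Prod.mk_sub_mk, sub_zero, sub_zero, Prod.norm_def]
    refine max_lt (hu.trans_lt hρε) ?_
    rw [Real.norm_of_nonneg (sub_nonneg.2 hu)]
    exact (sub_le_self _ (norm_nonneg u)).trans_lt hρε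
  -- The disc of radius ρ in `S` is pushed down by ρ - ‖s‖. The push is zero on the boundary, so it
  -- glues continuously with the inclusion outside.
  let ζ : S → EuclideanSpace ℝ (Fin n) := fun s =>
    if ‖s‖ ≤ ρ then φ (ξ (s, ρ - ‖(s : EuclideanSpace ℝ (Fin n))‖)) - z else s
  have hζc : Continuous ζ := by
    refine continuous_if_le continuous_norm continuous_const (fun s hs => ?_)
      continuous_subtype_val.continuousOn fun s hs => ?_
    · obtain ⟨h1, h2, -⟩ := hD s hs
      exact (ContinuousAt.comp
        (f := fun s : S => ((s : EuclideanSpace ℝ (Fin n)), ρ - ‖(s : EuclideanSpace ℝ (Fin n))‖))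
        (hηc _ h1 h2) (by fun_prop)).continuousWithinAt
    · have hs' : ‖(s : EuclideanSpace ℝ (Fin n))‖ = ρ := hs
      have h1 := (hD s hs'.le).1
      simp only [ξ, hs', sub_self, zero_smul, sub_zero]
      rw [φ.right_inv h1, add_sub_cancel_left]
  -- At a zero of the projection, `ζ s` is orthogonal to `S`. If ‖s‖ ≤ ρ, then `f (z + ζ s) ≥ f z`,
  -- yet this value is `f (z + s) - (ρ - ‖s‖)`, which is smaller than `f z`: by the push if `s = 0`,
  -- by the strict maximum along `S` otherwise.
  obtain ⟨s, hs⟩ := exists_eq_zero_of_eq_self_outside_ball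
    (r := fun s => S.orthogonalProjectionOnto (ζ s)) (S.orthogonalProjectionOnto.continuous.comp hζc) hρ.le
    (fun s hs => by
      rcases hs.eq_or_lt with h | h
      · have hs' : ‖(s : EuclideanSpace ℝ (Fin n))‖ = ρ := h.symm
        have h1 := (hD s hs'.le).1
        have h2 : ζ s = s := by
          simp only [ζ]
          rw [if_pos h.symm.le]
          simp only [ξ, hs', sub_self, zero_smul, sub_zero]
          rw [φ.right_inv h1, add_sub_cancel_left]
        simp only [h2, Submodule.orthogonalProjectionOnto_mem_subspace_eq_self]
      · have h2 : ζ s = s := if_neg (not_le.2 h)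
        simp only [h2, Submodule.orthogonalProjectionOnto_mem_subspace_eq_self])
  simp only [Submodule.orthogonalProjectionOnto_eq_zero_iff] at hs
  by_cases hsρ : ‖s‖ ≤ ρ
  · obtain ⟨h1, h2, h3⟩ := hD s hsρ
    have hζs : ζ s = φ (ξ (s, ρ - ‖(s : EuclideanSpace ℝ (Fin n))‖)) - z := if_pos hsρ
    rw [hζs] at hs
    have hge := hmin _ hs h3
    rw [add_sub_cancel, hφ _ h2] at hge
    have hval := hφ _ (φ.map_target h1)
    rw [φ.right_inv h1] at hval
    have hξv : ξ (s, ρ - ‖(s : EuclideanSpace ℝ (Fin n))‖) ⟨0, hn⟩ =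
        φ.symm (z + s) ⟨0, hn⟩ - (ρ - ‖(s : EuclideanSpace ℝ (Fin n))‖) := by
      simp [ξ, e]
    rw [hξv] at hge
    have hsn : ‖(s : EuclideanSpace ℝ (Fin n))‖ ≤ ρ := hsρ
    rcases eq_or_ne (s : EuclideanSpace ℝ (Fin n)) 0 with h | h
    · rw [h, add_zero] at hval
      rw [h, norm_zero, add_zero] at hge
      linarith
    · have := hmax s s.2 h (hsn.trans_lt hρR)
      linarith
  · have hζs : ζ s = s := if_neg hsρ
    rw [hζs] at hs
    have : (s : EuclideanSpace ℝ (Fin n)) = 0 :=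
      inner_self_eq_zero.1 (hs s s.2)
    have h0 : s = 0 := Subtype.ext this
    rw [h0, norm_zero] at hsρ
    exact hsρ hρ.le

end NonRegular

/-! ### The radial homeomorphism taking 2h(s) - ‖s‖² to a squared norm -/

section RadialCharts

variable {E : Type*} [NormedAddCommGroup E] [InnerProductSpace ℝ E]
  {P : Finset E} {hP : P.Nonempty}

/-- The support function of a finite set `P` grows linearly on a subspace on which it is positive
away from the origin. -/
theorem exists_mul_norm_le_maxInner [FiniteDimensional ℝ E] {S : Submodule ℝ E}
    (hpos : ∀ s ∈ S, s ≠ 0 → 0 < maxInner P hP s) :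
    ∃ κ > 0, ∀ s ∈ S, κ * ‖s‖ ≤ maxInner P hP s := by
  have hK : IsCompact (Metric.sphere 0 1 ∩ (S : Set E)) :=
    (isCompact_sphere 0 1).inter_right (Submodule.closed_of_finiteDimensional S)
  obtain ⟨κ, hκ, hmin⟩ : ∃ κ > 0, ∀ u ∈ S, ‖u‖ = 1 → κ ≤ maxInner P hP u := by
    rcases (Metric.sphere 0 1 ∩ (S : Set E)).eq_empty_or_nonempty with h | h
    · refine ⟨1, one_pos, fun u hu hu1 => ?_⟩
      have : u ∈ Metric.sphere 0 1 ∩ (S : Set E) := ⟨by simpa using hu1, hu⟩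
      rw [h] at this
      exact this.elim
    · obtain ⟨u₀, hu₀, hmin⟩ := hK.exists_isMinOn h (continuous_maxInner hP).continuousOn
      refine ⟨_, hpos u₀ hu₀.2 fun h0 => ?_, fun u hu hu1 => hmin ⟨by simpa using hu1, hu⟩⟩
      have := hu₀.1
      simp [h0] at this
  refine ⟨κ, hκ, fun s hs => ?_⟩
  rcases eq_or_ne s 0 with rfl | hs0
  · simp
  · have h1 := hmin (‖s‖⁻¹ • s) (S.smul_mem _ hs) (norm_smul_inv_norm hs0)
    rwa [maxInner_smul (by positivity), inv_mul_eq_div,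
      le_div_iff₀ (norm_pos_iff.2 hs0)] at h1

/-- The radial map with `‖radialRoot s‖ ^ 2 = 2 * maxInner s - ‖s‖ ^ 2`. -/
noncomputable def radialRoot (P : Finset E) (hP : P.Nonempty) (s : E) : E :=
  (√(2 * maxInner P hP s - ‖s‖ ^ 2) * ‖s‖⁻¹) • s

/-- The local inverse of `radialRoot`. -/
noncomputable def radialRootInv (P : Finset E) (hP : P.Nonempty) (q : E) : E :=
  (‖q‖ ^ 2 / (maxInner P hP q + √(maxInner P hP q ^ 2 - ‖q‖ ^ 4))) • q

theorem norm_radialRoot_le (s : E) :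
    ‖radialRoot P hP s‖ ≤ √(2 * maxInner P hP s - ‖s‖ ^ 2) := by
  rw [radialRoot, norm_smul, Real.norm_of_nonneg (by positivity), mul_assoc]
  exact mul_le_of_le_one_right (Real.sqrt_nonneg _) inv_mul_le_one

-- At the origin, the norm is squeezed by a root tending to 0. Continuity is global because `√` is 0
-- on negative numbers.
open Filter Topology in
theorem continuous_radialRoot (hP : P.Nonempty) : Continuous (radialRoot P hP) := by
  have hc := continuous_maxInner hP
  rw [continuous_iff_continuousAt]
  intro s
  rcases eq_or_ne s 0 with rfl | hs
  · have h0 : radialRoot P hP 0 = 0 := by simp [radialRoot]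
    rw [ContinuousAt, h0, tendsto_zero_iff_norm_tendsto_zero]
    refine squeeze_zero (fun _ => norm_nonneg _) norm_radialRoot_le ?_
    have : Continuous fun s => √(2 * maxInner P hP s - ‖s‖ ^ 2) := by fun_prop
    simpa using this.tendsto 0
  · have h1 : ContinuousAt (fun s : E => ‖s‖⁻¹) s :=
      continuous_norm.continuousAt.inv₀ (norm_ne_zero_iff.2 hs)
    have h2 : Continuous fun s => √(2 * maxInner P hP s - ‖s‖ ^ 2) := by fun_prop
    exact (h2.continuousAt.mul h1).smul continuousAt_id

variable {S : Submodule ℝ E} {κ : ℝ}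

theorem radialRoot_mem {s : E} (hs : s ∈ S) : radialRoot P hP s ∈ S := S.smul_mem _ hs

theorem radialRootInv_mem {s : E} (hs : s ∈ S) : radialRootInv P hP s ∈ S := S.smul_mem _ hs

/-- Linear growth dominates the square on the ball of radius κ. This makes the radicands of
`radialRoot` and `radialRootInv` nonnegative there. -/
theorem sq_norm_le_maxInner (hκS : ∀ s ∈ S, κ * ‖s‖ ≤ maxInner P hP s) {s : E}
    (hs : s ∈ S) (hsκ : ‖s‖ ≤ κ) : ‖s‖ ^ 2 ≤ maxInner P hP s := by
  refine le_trans ?_ (hκS s hs)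
  rw [sq]
  exact mul_le_mul_of_nonneg_right hsκ (norm_nonneg _)

theorem maxInner_pos (hκ : 0 < κ) (hκS : ∀ s ∈ S, κ * ‖s‖ ≤ maxInner P hP s) {s : E}
    (hs : s ∈ S) (hs0 : s ≠ 0) : 0 < maxInner P hP s :=
  (mul_pos hκ (norm_pos_iff.2 hs0)).trans_le (hκS s hs)

theorem sq_norm_radialRoot (hκS : ∀ s ∈ S, κ * ‖s‖ ≤ maxInner P hP s) {s : E}
    (hs : s ∈ S) (hsκ : ‖s‖ ≤ κ) :
    ‖radialRoot P hP s‖ ^ 2 = 2 * maxInner P hP s - ‖s‖ ^ 2 := by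
  have h1 := sq_norm_le_maxInner hκS hs hsκ
  rcases eq_or_ne s 0 with rfl | hs0
  · simp [radialRoot]
  · have := norm_pos_iff.2 hs0
    rw [radialRoot, norm_smul, Real.norm_of_nonneg (by positivity), mul_assoc,
      inv_mul_cancel₀ this.ne', mul_one, Real.sq_sqrt (by nlinarith)]

-- The projection is composed in because the support function, and with it the denominator, is known
-- to be positive only on S \ {0}. At points projecting to 0, the bound ‖q‖²/κ gives continuity.
open Filter Topology in
theorem continuous_radialRootInv_comp [S.HasOrthogonalProjection] (hκ : 0 < κ)
    (hκS : ∀ s ∈ S, κ * ‖s‖ ≤ maxInner P hP s) :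
    Continuous fun q => radialRootInv P hP (S.starProjection q) := by
  have hle : ∀ q ∈ S, ‖radialRootInv P hP q‖ ≤ ‖q‖ ^ 2 / κ := by
    intro q hq
    rcases eq_or_ne q 0 with rfl | hq0
    · simp [radialRootInv]
    · have hn := norm_pos_iff.2 hq0
      have hm := maxInner_pos hκ hκS hq hq0
      rw [radialRootInv, norm_smul, Real.norm_of_nonneg (by positivity), div_mul_eq_mul_div,
        div_le_div_iff₀ (by positivity) hκ, mul_assoc]
      gcongr
      rw [mul_comm]
      exact (hκS q hq).trans (le_add_of_nonneg_right (Real.sqrt_nonneg _))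
  rw [continuous_iff_continuousAt]
  intro q
  have hmem : ∀ q, S.starProjection q ∈ S := Submodule.starProjection_apply_mem S
  have hPc : Continuous fun q => S.starProjection q := S.starProjection.continuous
  rcases eq_or_ne (S.starProjection q) 0 with hq | hq
  · have h0 : radialRootInv P hP (S.starProjection q) = 0 := by simp [hq, radialRootInv]
    rw [ContinuousAt, h0, tendsto_zero_iff_norm_tendsto_zero]
    refine squeeze_zero (fun _ => norm_nonneg _) (fun q => hle _ (hmem q)) ?_
    have : Continuous fun q => ‖S.starProjection q‖ ^ 2 / κ := by fun_prop
    simpa [hq] using this.tendsto q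
  · have hc : Continuous fun q => maxInner P hP (S.starProjection q) :=
      (continuous_maxInner hP).comp hPc
    have hm := maxInner_pos hκ hκS (hmem q) hq
    refine ContinuousAt.smul (ContinuousAt.div₀ (by fun_prop) (by fun_prop) ?_) (by fun_prop)
    positivity

/-- The factor `t` is the smaller root of ‖q‖² t² - 2h(q) t + ‖q‖² = 0, rationalised so that its
denominator is h(q) plus a square root. The discriminant is nonnegative since ‖q‖ ≤ κ. -/
theorem exists_radialRootInv_eq_smul (hκ : 0 < κ) (hκS : ∀ s ∈ S, κ * ‖s‖ ≤ maxInner P hP s)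
    {q : E} (hq : q ∈ S) (hqκ : ‖q‖ ≤ κ) (hq0 : q ≠ 0) :
    ∃ t > 0, radialRootInv P hP q = t • q ∧
      2 * (t * maxInner P hP q) - t ^ 2 * ‖q‖ ^ 2 = ‖q‖ ^ 2 := by
  have hn := norm_pos_iff.2 hq0
  have hm := maxInner_pos hκ hκS hq hq0
  have hle := sq_norm_le_maxInner hκS hq hqκ
  set m := maxInner P hP q with hmdef
  have hD : √(m ^ 2 - ‖q‖ ^ 4) ^ 2 = m ^ 2 - ‖q‖ ^ 4 := Real.sq_sqrt (by
    have := pow_le_pow_left₀ (by positivity) hle 2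
    nlinarith)
  refine ⟨‖q‖ ^ 2 / (m + √(m ^ 2 - ‖q‖ ^ 4)), by positivity, rfl, ?_⟩
  have hD0 := Real.sqrt_nonneg (m ^ 2 - ‖q‖ ^ 4)
  set D := √(m ^ 2 - ‖q‖ ^ 4)
  field_simp
  linear_combination -hD

theorem two_mul_maxInner_radialRootInv_sub (hκ : 0 < κ)
    (hκS : ∀ s ∈ S, κ * ‖s‖ ≤ maxInner P hP s) {q : E} (hq : q ∈ S) (hqκ : ‖q‖ ≤ κ) :
    2 * maxInner P hP (radialRootInv P hP q) - ‖radialRootInv P hP q‖ ^ 2 = ‖q‖ ^ 2 := by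
  rcases eq_or_ne q 0 with rfl | hq0
  · simp [radialRootInv]
  · obtain ⟨t, ht, h, heq⟩ := exists_radialRootInv_eq_smul hκ hκS hq hqκ hq0
    rw [h, maxInner_smul ht.le, norm_smul, Real.norm_of_nonneg ht.le, mul_pow, heq]

theorem radialRoot_radialRootInv (hκ : 0 < κ)
    (hκS : ∀ s ∈ S, κ * ‖s‖ ≤ maxInner P hP s) {q : E} (hq : q ∈ S) (hqκ : ‖q‖ ≤ κ) :
    radialRoot P hP (radialRootInv P hP q) = q := by
  have h1 := two_mul_maxInner_radialRootInv_sub hκ hκS hq hqκ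
  rw [radialRoot, h1, Real.sqrt_sq (norm_nonneg q)]
  rcases eq_or_ne q 0 with rfl | hq0
  · simp
  · obtain ⟨t, ht, h, -⟩ := exists_radialRootInv_eq_smul hκ hκS hq hqκ hq0
    have hn := norm_pos_iff.2 hq0
    rw [h, norm_smul, Real.norm_of_nonneg ht.le, smul_smul,
      show ‖q‖ * (t * ‖q‖)⁻¹ * t = 1 by field_simp, one_smul]

theorem radialRootInv_radialRoot (hκ : 0 < κ)
    (hκS : ∀ s ∈ S, κ * ‖s‖ ≤ maxInner P hP s) {s : E} (hs : s ∈ S) (hsκ : ‖s‖ ≤ κ) :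
    radialRootInv P hP (radialRoot P hP s) = s := by
  rcases eq_or_ne s 0 with rfl | hs0
  · simp [radialRoot, radialRootInv]
  have hn := norm_pos_iff.2 hs0
  have hm := maxInner_pos hκ hκS hs hs0
  have hle := sq_norm_le_maxInner hκS hs hsκ
  have hsq := sq_norm_radialRoot hκS hs hsκ
  set m := maxInner P hP s with hmdef
  have hpos : 0 < 2 * m - ‖s‖ ^ 2 := by linarith
  set μ := √(2 * m - ‖s‖ ^ 2) * ‖s‖⁻¹ with hμ
  have hμ0 : 0 < μ := by positivity
  have hA : radialRoot P hP s = μ • s := rfl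
  have hμsq : μ ^ 2 * ‖s‖ ^ 2 = 2 * m - ‖s‖ ^ 2 := by
    rw [← hsq, hA, norm_smul, Real.norm_of_nonneg hμ0.le, mul_pow μ]
  have hq4 : ‖radialRoot P hP s‖ ^ 4 = (2 * m - ‖s‖ ^ 2) ^ 2 := by rw [← hsq]; ring
  have hmA : maxInner P hP (radialRoot P hP s) = μ * m := by rw [hA, maxInner_smul hμ0.le]
  -- The radicand is the square of μ(m - ‖s‖²). The bound ‖s‖² ≤ m fixes the sign of the root, so
  -- `radialRootInv` selects the branch that returns `s`.
  have hroot : √((μ * m) ^ 2 - (2 * m - ‖s‖ ^ 2) ^ 2) = μ * (m - ‖s‖ ^ 2) := by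
    rw [← Real.sqrt_sq (mul_nonneg hμ0.le (sub_nonneg.2 hle))]
    congr 1
    linear_combination (2 * m - ‖s‖ ^ 2) * hμsq
  rw [radialRootInv, hsq, hmA, hq4, hroot, hA, smul_smul]
  have : (2 * m - ‖s‖ ^ 2) / (μ * m + μ * (m - ‖s‖ ^ 2)) * μ = 1 := by
    rw [show μ * m + μ * (m - ‖s‖ ^ 2) = μ * (2 * m - ‖s‖ ^ 2) by ring]
    field_simp
  rw [this, one_smul]

end RadialCharts

/-! ### Nondegenerate critical points -/

section Nondegenerate

variable {n : ℕ}

/-- Euclidean coordinates adapted to a subspace. -/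
theorem exists_linearIsometryEquiv_adapted (S : Submodule ℝ (EuclideanSpace ℝ (Fin n))) :
    ∃ L : EuclideanSpace ℝ (Fin n) ≃ₗᵢ[ℝ] EuclideanSpace ℝ (Fin n), ∀ p,
      ‖S.starProjection (L p)‖ ^ 2 = ∑ i : Fin n with i.val < Module.finrank ℝ S, p i ^ 2 ∧
      ‖L p - S.starProjection (L p)‖ ^ 2 =
        ∑ i : Fin n with Module.finrank ℝ S ≤ i.val, p i ^ 2 := by
  set m := Module.finrank ℝ S
  let b₀ := stdOrthonormalBasis ℝ S
  let v : Fin n → EuclideanSpace ℝ (Fin n) := fun i =>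
    if h : i.val < m then (b₀ ⟨i.val, h⟩ : EuclideanSpace ℝ (Fin n)) else 0
  let I : Set (Fin n) := {i | i.val < m}
  have hv : Orthonormal ℝ (I.domRestrict v) := by
    have h1 : I.domRestrict v = fun i => ((b₀ ⟨i.1.val, i.2⟩ : S) : EuclideanSpace ℝ (Fin n)) := by
      funext i
      exact dif_pos i.2
    rw [h1]
    exact (b₀.orthonormal.comp_linearIsometry S.subtypeₗᵢ).comp
      (fun i : I => (⟨i.1.val, i.2⟩ : Fin m)) fun i j hij => by
        have := congrArg Fin.val hij
        exact Subtype.ext (Fin.ext this)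
  -- An orthonormal basis of `S` occupies the first `m` places of a basis of the whole space, so
  -- projecting on `S` truncates the coordinates.
  obtain ⟨b, hb⟩ := hv.exists_orthonormalBasis_extension_of_card_eq (by simp)
  have hmn : m ≤ n := by simpa using Submodule.finrank_le S
  have hbS : ∀ j : Fin m, b ⟨j.val, j.2.trans_le hmn⟩ = b₀ j := fun j => by
    rw [hb _ j.2]
    exact dif_pos j.2
  have hmem : ∀ i : Fin n, i.val < m → b i ∈ S := fun i hi => by
    have := hbS ⟨i.val, hi⟩
    simp only [Fin.eta] at this
    rw [this]
    exact Subtype.property _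
  have horth : ∀ i : Fin n, m ≤ i.val → b i ∈ Sᗮ := fun i hi => by
    intro x hx
    have hx' := congrArg Subtype.val (b₀.sum_repr ⟨x, hx⟩)
    simp only [AddSubmonoidClass.coe_finsetSum, Submodule.coe_smul] at hx'
    rw [← hx', sum_inner]
    refine Finset.sum_eq_zero fun j _ => ?_
    rw [real_inner_smul_left, ← hbS j, b.inner_eq_zero (fun h => ?_), mul_zero]
    have h2 := congrArg Fin.val h
    simp only at h2
    exact absurd j.2 (not_lt.2 (h2 ▸ hi))
  refine ⟨b.repr.symm, fun p => ?_⟩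
  let q : EuclideanSpace ℝ (Fin n) := WithLp.toLp 2 fun i => if i.val < m then p i else 0
  have hq : ∀ i, q i = if i.val < m then p i else 0 := fun i => rfl
  have hproj : S.starProjection (b.repr.symm p) = b.repr.symm q := by
    refine Submodule.eq_starProjection_of_mem_orthogonal (K := S) ?_ ?_
    · rw [← b.sum_repr_symm]
      refine S.sum_mem fun i _ => ?_
      rw [hq]
      split_ifs with h
      · exact S.smul_mem _ (hmem i h)
      · rw [zero_smul]; exact S.zero_mem
    · rw [← map_sub, ← b.sum_repr_symm]
      refine Sᗮ.sum_mem fun i _ => ?_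
      rw [PiLp.sub_apply, hq]
      split_ifs with h
      · rw [sub_self, zero_smul]; exact Sᗮ.zero_mem
      · exact Sᗮ.smul_mem _ (horth i (not_lt.1 h))
  rw [hproj, ← map_sub, LinearIsometryEquiv.norm_map, LinearIsometryEquiv.norm_map,
    EuclideanSpace.real_norm_sq_eq, EuclideanSpace.real_norm_sq_eq, Finset.sum_filter,
    Finset.sum_filter]
  constructor <;> refine Finset.sum_congr rfl fun i _ => ?_
  · rw [hq]
    split_ifs <;> simp
  · rw [PiLp.sub_apply, hq]
    rcases lt_or_ge i.val m with h | h
    · simp [h, not_le.2 h]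
    · simp [h, not_lt.2 h]

/-- If a nonnegative function `f` satisfies `f (z + u) ^ 2 = c ^ 2 + ‖u‖ ^ 2 - 2 * h u` for small `u`
and the support function `h` of a subset of `S`, positive on `S` away from the origin, then `f` is
topologically a nondegenerate quadratic form near `z`. -/
theorem exists_chart_of_sq_eq_add_sub_maxInner {f : EuclideanSpace ℝ (Fin n) → ℝ}
    (hf : Continuous f) (hf0 : ∀ y, 0 ≤ f y) {z : EuclideanSpace ℝ (Fin n)} (hz : 0 < f z)
    {P : Finset (EuclideanSpace ℝ (Fin n))} {hP : P.Nonempty} {R : ℝ} (hR : 0 < R)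
    (hloc : ∀ u, ‖u‖ < R → f (z + u) ^ 2 = f z ^ 2 + ‖u‖ ^ 2 - 2 * maxInner P hP u)
    {S : Submodule ℝ (EuclideanSpace ℝ (Fin n))} (hPS : ∀ a ∈ P, a ∈ S)
    {κ : ℝ} (hκ : 0 < κ) (hκS : ∀ s ∈ S, κ * ‖s‖ ≤ maxInner P hP s) :
    ∃ φ : OpenPartialHomeomorph (EuclideanSpace ℝ (Fin n)) (EuclideanSpace ℝ (Fin n)),
      0 ∈ φ.source ∧ φ 0 = z ∧ ∀ p ∈ φ.source,
        f (φ p) = f z - ‖S.starProjection p‖ ^ 2 + ‖p - S.starProjection p‖ ^ 2 := by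
  set Q := S.starProjection with hQ
  have hmem : ∀ x, Q x ∈ S := Submodule.starProjection_apply_mem S
  have hfix : ∀ x ∈ S, Q x = x := fun x hx => Submodule.starProjection_eq_self_iff.2 hx
  have hQQ : ∀ x, Q (Q x) = Q x := fun x => hfix _ (hmem x)
  have hpyth : ∀ x, ‖x‖ ^ 2 = ‖Q x‖ ^ 2 + ‖x - Q x‖ ^ 2 := fun x => by
    have h1 : (inner ℝ (Q x) (x - Q x) : ℝ) = 0 :=
      Submodule.sub_starProjection_mem_orthogonal (K := S) x _ (hmem x)
    conv_lhs => rw [← add_sub_cancel (Q x) x]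
    rw [norm_add_sq_real, h1]; ring
  have hloc' : ∀ u, ‖u‖ < R → f (z + u) ^ 2 =
      f z ^ 2 + ‖u - Q u‖ ^ 2 - (2 * maxInner P hP (Q u) - ‖Q u‖ ^ 2) := fun u hu => by
    rw [hloc u hu, hpyth u, hQ, maxInner_starProjection hPS]; ring
  -- `G` is the desired normal form. Scaling `p` by `k p` multiplies the quadratic form `G - f z` by
  -- `G + f z`, giving G² - f(z)², the form suited to `hloc'`. The inverse `ψ` can use `f (z + u)`
  -- in place of `G`, as the two agree at corresponding points.
  let G : EuclideanSpace ℝ (Fin n) → ℝ := fun p => f z - ‖Q p‖ ^ 2 + ‖p - Q p‖ ^ 2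
  let k : EuclideanSpace ℝ (Fin n) → ℝ := fun p => √(G p + f z)
  let φ : EuclideanSpace ℝ (Fin n) → EuclideanSpace ℝ (Fin n) :=
    fun p => radialRootInv P hP (Q (k p • p)) + k p • (p - Q p)
  let ψ : EuclideanSpace ℝ (Fin n) → EuclideanSpace ℝ (Fin n) :=
    fun u => (√(f (z + u) + f z))⁻¹ • (radialRoot P hP (Q u) + (u - Q u))
  have hGc : Continuous G := by fun_prop
  have hkc : Continuous k := by fun_prop
  have hφc : Continuous φ :=
    ((continuous_radialRootInv_comp hκ hκS).comp (hkc.smul continuous_id)).add (by fun_prop)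
  have hfz : ∀ u, 0 < f (z + u) + f z := fun u => by linarith [hf0 (z + u)]
  have hψc : Continuous ψ := by
    have h1 : Continuous fun u => (√(f (z + u) + f z))⁻¹ :=
      Continuous.inv₀ (by fun_prop) fun u => (Real.sqrt_pos.2 (hfz u)).ne'
    exact h1.smul (((continuous_radialRoot hP).comp Q.continuous).add (by fun_prop))
  have hQφ : ∀ p, Q (φ p) = radialRootInv P hP (Q (k p • p)) := fun p => by
    simp only [φ]
    rw [map_add, hfix _ (radialRootInv_mem (hmem _)), map_smul Q _ (p - Q p), map_sub, hQQ,
      sub_self, smul_zero, add_zero]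
  have hφQ : ∀ p, φ p - Q (φ p) = k p • (p - Q p) := fun p => by
    rw [hQφ]; simp only [φ]; rw [add_sub_cancel_left]
  have hQψ : ∀ u, Q (ψ u) = (√(f (z + u) + f z))⁻¹ • radialRoot P hP (Q u) := fun u => by
    simp only [ψ]
    rw [map_smul, map_add, hfix _ (radialRoot_mem (hmem _)), map_sub, hQQ, sub_self, add_zero]
  have hψQ : ∀ u, ψ u - Q (ψ u) = (√(f (z + u) + f z))⁻¹ • (u - Q u) := fun u => by
    rw [hQψ]; simp only [ψ]; rw [← smul_sub, add_sub_cancel_left]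
  let U : Set (EuclideanSpace ℝ (Fin n)) :=
    {p | 0 < G p} ∩ ({p | ‖Q (k p • p)‖ < κ} ∩ {p | ‖φ p‖ < R})
  have hU : IsOpen U := (isOpen_lt continuous_const hGc).inter
    ((isOpen_lt (by fun_prop) continuous_const).inter (isOpen_lt hφc.norm continuous_const))
  let V : Set (EuclideanSpace ℝ (Fin n)) := {u | ‖u‖ < R} ∩ {u | ‖Q u‖ < κ}
  have hV : IsOpen V := (isOpen_lt continuous_norm continuous_const).inter
    (isOpen_lt (by fun_prop) continuous_const)
  have hφ0 : φ 0 = 0 := by simp [φ, radialRootInv]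
  have hksq : ∀ p, 0 < G p → k p ^ 2 = G p + f z := fun p hp => Real.sq_sqrt (by linarith)
  have hfφ : ∀ p ∈ U, f (z + φ p) = G p := by
    rintro p ⟨hp1, hp2, hp3⟩
    -- The squares are compared; `0 < G p` is what allows the squares to be removed.
    refine (pow_left_inj₀ (hf0 _) (le_of_lt hp1) two_ne_zero).1 ?_
    rw [hloc' _ hp3, hφQ, hQφ, two_mul_maxInner_radialRootInv_sub hκ hκS (hmem _) (le_of_lt hp2),
      map_smul, norm_smul, norm_smul, mul_pow, mul_pow, Real.norm_eq_abs, sq_abs, hksq p hp1]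
    simp only [G]
    ring
  have hl : Set.LeftInvOn ψ φ U := by
    intro p hp
    have hk : √(f (z + φ p) + f z) = k p := by rw [hfφ p hp]
    have hk0 : 0 < k p := Real.sqrt_pos.2 (by have : 0 < G p := hp.1; linarith)
    simp only [ψ]
    rw [hk, hφQ, hQφ, radialRoot_radialRootInv hκ hκS (hmem _) (le_of_lt hp.2.1), map_smul,
      ← smul_add, add_sub_cancel, smul_smul, inv_mul_cancel₀ hk0.ne', one_smul]
  have hr : Set.LeftInvOn φ ψ V := by
    rintro u ⟨hu1, hu2⟩
    have hsq := Real.sq_sqrt (hfz u).le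
    have hpos := Real.sqrt_pos.2 (hfz u)
    have hGψ : G (ψ u) = f (z + u) := by
      simp only [G]
      rw [hψQ, hQψ, norm_smul, norm_smul, mul_pow, mul_pow, Real.norm_eq_abs, sq_abs, inv_pow, hsq,
        sq_norm_radialRoot hκS (hmem u) (le_of_lt hu2)]
      have h1 := hloc' u hu1
      have h2 := (hfz u).ne'
      field_simp
      linear_combination -h1
    have hk : k (ψ u) = √(f (z + u) + f z) := by simp only [k]; rw [hGψ]
    simp only [φ]
    rw [map_smul, hψQ, hQψ, hk, smul_smul, smul_smul, mul_inv_cancel₀ hpos.ne', one_smul, one_smul,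
      radialRootInv_radialRoot hκ hκS (hmem u) (le_of_lt hu2), add_sub_cancel]
  obtain ⟨Φ, h0, hΦ, hΦU⟩ := exists_openPartialHomeomorph_of_leftInvOn hU hV hφc.continuousOn
    hψc.continuousOn (a := 0) ⟨by simpa [G] using hz, by simpa using hκ, by simpa [hφ0] using hR⟩
    ⟨by simpa [hφ0] using hR, by simpa [hφ0] using hκ⟩ hl hr
  refine ⟨Φ.transHomeomorph (Homeomorph.addLeft z), h0, ?_, fun p hp => ?_⟩
  · simp [hΦ, hφ0]
  · have h1 : (Φ.transHomeomorph (Homeomorph.addLeft z)) p = z + φ p := by rw [← hΦ]; rfl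
    rw [h1, hfφ p (hΦU hp)]

variable {X : Set (EuclideanSpace ℝ (Fin n))} {z : EuclideanSpace ℝ (Fin n)}

/-- A point outside of `X` in the relative interior of the convex hull of its nearest points is
nondegenerate critical for the distance function. -/
theorem isNondegTopCriticalPt_infDist (hX : X.Finite) (hX0 : X.Nonempty) (hzX : z ∉ X)
    (h : ¬ ∃ v ∈ nearestSpan X z, v ≠ 0 ∧ ∀ x ∈ nearestPts X z, inner ℝ v (x - z) ≤ (0 : ℝ)) :
    IsNondegTopCriticalPt (fun y => Metric.infDist y X) z
      (Module.finrank ℝ (nearestSpan X z)) := by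
  obtain ⟨P, hP, hPX, R, hR, hloc⟩ := exists_finset_sq_infDist_eq hX hX0 z
  have hc : 0 < Metric.infDist z X := (hX.isClosed.notMem_iff_infDist_pos hX0).1 hzX
  have hSP := nearestSpan_eq_span hPX
  set S := nearestSpan X z with hS
  have hPS : ∀ a ∈ P, a ∈ S := fun a ha => hSP ▸ Submodule.subset_span ha
  have hpos : ∀ s ∈ S, s ≠ 0 → 0 < maxInner P hP s := by
    intro s hs hs0
    by_contra! hle
    refine h ⟨s, hs, hs0, fun x hx => ?_⟩
    have ha : x - z ∈ P := by
      rw [← Finset.mem_coe, hPX]; exact ⟨x, hx, rfl⟩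
    exact (inner_le_maxInner ha s).trans hle
  obtain ⟨κ, hκ, hκS⟩ := exists_mul_norm_le_maxInner hpos
  -- For ‖s‖ < κ, ‖s‖² ≤ h(s) < 2h(s), so the distance drops along `S`; on the orthogonal complement
  -- the support function vanishes and the distance cannot drop.
  refine ⟨not_isTopRegularPt_of_saddle (S := S) (R := min R κ) (by positivity) ?_ ?_,
    by simpa using Submodule.finrank_le S, ?_⟩
  · intro s hs hs0 hsR
    refine lt_of_pow_lt_pow_left₀ 2 Metric.infDist_nonneg ?_
    rw [hloc s (hsR.trans_le (min_le_left _ _))]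
    have h1 := sq_norm_le_maxInner hκS hs (hsR.le.trans (min_le_right _ _))
    have h2 := hpos s hs hs0
    linarith
  · intro w hw hwR
    refine le_of_sq_le_sq ?_ Metric.infDist_nonneg
    rw [hloc w (hwR.trans_le (min_le_left _ _)), ← maxInner_starProjection hPS,
      (Submodule.starProjection_apply_eq_zero_iff S).2 hw, maxInner_zero]
    nlinarith [sq_nonneg ‖w‖]
  · obtain ⟨φ, h0, hφ0, hφ⟩ := exists_chart_of_sq_eq_add_sub_maxInner
      (Metric.continuous_infDist_pt X) (fun _ => Metric.infDist_nonneg) hc hR hloc hPS hκ hκS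
    obtain ⟨L, hL⟩ := exists_linearIsometryEquiv_adapted S
    refine ⟨L.toHomeomorph.transOpenPartialHomeomorph φ, ?_, ?_, fun p hp => ?_⟩
    · simpa using h0
    · simpa using hφ0
    · have h1 : (L.toHomeomorph.transOpenPartialHomeomorph φ) p = φ (L p) := rfl
      have h2 : L p ∈ φ.source := hp
      simp only [h1, hφ _ h2, (hL p).1, (hL p).2]

/-- The points of `X` are minima, nondegenerate of index `0`, of the distance function. -/
theorem isNondegTopCriticalPt_infDist_of_mem (hX : X.Finite) (hzX : z ∈ X) :
    IsNondegTopCriticalPt (fun y => Metric.infDist y X) z 0 := by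
  obtain ⟨P, hP, hPX, R, hR, hloc⟩ := exists_finset_sq_infDist_eq hX ⟨z, hzX⟩ z
  have hz0 : Metric.infDist z X = 0 := Metric.infDist_zero_of_mem hzX
  -- The only nearest point of `z` is `z` itself, so every vector of `P` is zero.
  have hmax : ∀ u, maxInner P hP u = 0 := by
    intro u
    obtain ⟨a, ha, h⟩ := exists_maxInner_eq hP u
    obtain ⟨x, hx, rfl⟩ : a ∈ (fun x => x - z) '' nearestPts X z := hPX ▸ ha
    have hzx : z = x := dist_eq_zero.1 (hx.2.trans hz0)
    rw [h, ← hzx]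
    simp
  have hloc' : ∀ u, ‖u‖ < R → Metric.infDist (z + u) X = ‖u‖ := by
    intro u hu
    refine (pow_left_inj₀ Metric.infDist_nonneg (norm_nonneg u) two_ne_zero).1 ?_
    rw [hloc u hu, hmax, hz0]; ring
  -- With `S = ⊥` the maximum condition is vacuous and the orthogonal complement is the whole space.
  refine ⟨not_isTopRegularPt_of_saddle (S := ⊥) hR ?_ ?_, Nat.zero_le n, ?_⟩
  · intro s hs hs0
    exact absurd ((Submodule.mem_bot ℝ).1 hs) hs0
  · intro w _ _
    simp only [hz0]
    exact Metric.infDist_nonneg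
  -- The distance is locally ‖u‖, so a radial map with ‖φ p‖ = ‖p‖² turns it into the sum of
  -- squares.
  · let φ : EuclideanSpace ℝ (Fin n) → EuclideanSpace ℝ (Fin n) := fun p => ‖p‖ • p
    let ψ : EuclideanSpace ℝ (Fin n) → EuclideanSpace ℝ (Fin n) := fun u => (√‖u‖)⁻¹ • u
    have hφc : Continuous φ := by fun_prop
    have hφn : ∀ p, ‖φ p‖ = ‖p‖ ^ 2 := fun p => by simp [φ, norm_smul, sq]
    have hψn : ∀ u, ‖ψ u‖ = √‖u‖ := fun u => by
      simp only [ψ]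
      rw [norm_smul, Real.norm_of_nonneg (by positivity), inv_mul_eq_div, Real.div_sqrt]
    have hψc : Continuous ψ := by
      rw [continuous_iff_continuousAt]
      intro u
      rcases eq_or_ne u 0 with rfl | hu
      · have h0 : ψ 0 = 0 := by simp [ψ]
        rw [ContinuousAt, h0, tendsto_zero_iff_norm_tendsto_zero]
        simp only [hψn]
        have : Continuous fun u : EuclideanSpace ℝ (Fin n) => √‖u‖ := by fun_prop
        simpa using this.tendsto 0
      · have h1 : √‖u‖ ≠ 0 := (Real.sqrt_pos.2 (norm_pos_iff.2 hu)).ne'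
        have h2 : ContinuousAt (fun u : EuclideanSpace ℝ (Fin n) => √‖u‖) u := by fun_prop
        exact (h2.inv₀ h1).smul continuousAt_id
    obtain ⟨Φ, h0, hΦ, hΦU⟩ := exists_openPartialHomeomorph_of_leftInvOn (φ := φ) (ψ := ψ)
      (U := {p | ‖φ p‖ < R}) (V := Set.univ) (a := 0)
      (isOpen_lt hφc.norm continuous_const) isOpen_univ hφc.continuousOn hψc.continuousOn
      (by simpa [φ] using hR) trivial
      (fun p _ => by
        simp only [ψ]
        rw [hφn, Real.sqrt_sq (norm_nonneg p)]
        rcases eq_or_ne p 0 with rfl | hp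
        · simp [φ]
        · simp only [φ]
          rw [smul_smul, inv_mul_cancel₀ (norm_ne_zero_iff.2 hp), one_smul])
      (fun u _ => by
        simp only [φ]
        rw [hψn]
        rcases eq_or_ne u 0 with rfl | hu
        · simp [ψ]
        · simp only [ψ]
          rw [smul_smul, mul_inv_cancel₀ (Real.sqrt_pos.2 (norm_pos_iff.2 hu)).ne', one_smul])
    refine ⟨Φ.transHomeomorph (Homeomorph.addLeft z), h0, ?_, fun p hp => ?_⟩
    · simp [hΦ, φ]
    · have h1 : (Φ.transHomeomorph (Homeomorph.addLeft z)) p = z + φ p := by rw [← hΦ]; rfl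
      have h2 : ‖φ p‖ < R := hΦU hp
      simp only [h1, hz0, hloc' _ h2, hφn, EuclideanSpace.real_norm_sq_eq]
      simp

end Nondegenerate

/-! ### Assembly of the cases -/

theorem theorem1 (n : ℕ) (X : Set (EuclideanSpace ℝ (Fin n))) (hX : X.Finite)
    (hX0 : X.Nonempty) :
    IsTopMorse (fun z => Metric.infDist z X) ∧
    (∀ x ∈ X, IsNondegTopCriticalPt (fun z => Metric.infDist z X) x 0) ∧
    (∀ z, z ∉ X → z ∈ convexHull ℝ (nearestPts X z) →
      ((∃ v ∈ nearestSpan X z, v ≠ 0 ∧ ∀ x ∈ nearestPts X z, inner ℝ v (x - z) ≤ 0) →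
        IsTopRegularPt (fun z => Metric.infDist z X) z) ∧
      ((¬ ∃ v ∈ nearestSpan X z, v ≠ 0 ∧ ∀ x ∈ nearestPts X z, inner ℝ v (x - z) ≤ 0) →
        IsNondegTopCriticalPt (fun z => Metric.infDist z X) z
          (Module.finrank ℝ (nearestSpan X z)))) ∧
    (∀ z, z ∉ X → z ∉ convexHull ℝ (nearestPts X z) →
      IsTopRegularPt (fun z => Metric.infDist z X) z) := by
  have h2 : ∀ z, z ∉ X → z ∈ convexHull ℝ (nearestPts X z) →
      ((∃ v ∈ nearestSpan X z, v ≠ 0 ∧ ∀ x ∈ nearestPts X z, inner ℝ v (x - z) ≤ 0) →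
        IsTopRegularPt (fun z => Metric.infDist z X) z) ∧
      ((¬ ∃ v ∈ nearestSpan X z, v ≠ 0 ∧ ∀ x ∈ nearestPts X z, inner ℝ v (x - z) ≤ 0) →
        IsNondegTopCriticalPt (fun z => Metric.infDist z X) z
          (Module.finrank ℝ (nearestSpan X z))) := fun z hzX hz =>
    ⟨isTopRegularPt_infDist_of_mem_convexHull hX hX0 hz, isNondegTopCriticalPt_infDist hX hX0 hzX⟩
  refine ⟨⟨Metric.continuous_infDist_pt X, fun z hz => ?_⟩,
    fun x hx => isNondegTopCriticalPt_infDist_of_mem hX hx, h2,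
    fun z _ hz => isTopRegularPt_infDist_of_notMem_convexHull hX hX0 hz⟩
  -- The cases exhaust the space; those that yield a regular point contradict the criticality of
  -- `z`.
  by_cases hzX : z ∈ X
  · exact ⟨0, isNondegTopCriticalPt_infDist_of_mem hX hzX⟩
  by_cases hzc : z ∈ convexHull ℝ (nearestPts X z)
  · by_cases hv : ∃ v ∈ nearestSpan X z, v ≠ 0 ∧ ∀ x ∈ nearestPts X z, inner ℝ v (x - z) ≤ (0 : ℝ)
    · exact absurd ((h2 z hzX hzc).1 hv) hz
    · exact ⟨_, (h2 z hzX hzc).2 hv⟩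
  · exact absurd (isTopRegularPt_infDist_of_notMem_convexHull hX hX0 hzc) hz
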